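/- For a positive integer $m$ write $[m]=\{0,\dots,m-1\}$. Let $U$ be a finite set of keys; a \emph{hash class} is a nonempty set of functions with domain $U$, from which functions are drawn uniformly at random. A hash class $\mathcal F$ of functions $U\to[\ell]$ is \emph{2-universal} if $\Pr_{g\in\mathcal F}(g(x)=g(y))\le 2/\ell$ for all distinct $x,y\in U$; a hash class $\mathcal H$ of functions $U\to[m]$ is \emph{2-wise independent} if $\Pr_{f\in\mathcal H}(f(x)=i\wedge f(y)=j)=1/m^2$ for all distinct $x,y\in U$ and all $i,j\in[m]$. Given a 2-universal class $\mathcal F$ with range $[\ell]$ and a 2-wise independent class $\mathcal H$ with range $[m]$, let $\mathcal Z=\mathcal Z^{c,2}_{\ell,m}$ be the class of all tuples $(f_1,f_2,g_1,\dots,g_c,z^{(1)},z^{(2)})$ with $f_1,f_2\in\mathcal H$, $g_1,\dots,g_c\in\mathcal F$ and tables $z^{(i)}\in[m]^{\{1,\dots,c\}\times[\ell]}$, made into a probability space by the uniform distribution; such a tuple defines the pair $(h_1,h_2)$ of hash functions $$h_i(x)=\Bigl(f_i(x)+\sum_{j=1}^{c} z^{(i)}[j,g_j(x)]\Bigr)\bmod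 m,\qquad x\in U,\ i\in\{1,2\}.$$ For $S\subseteq U$ let $G(S,h_1,h_2)$ be the bipartite multigraph whose vertices are two disjoint copies of $[m]$ and which has, for each $x\in S$, one edge between $h_1(x)$ in the first copy and $h_2(x)$ in the second copy. The \emph{excess} $\mathrm{ex}(G)$ of a finite multigraph $G$ is the minimum number of edges one has to remove from $G$ so that every connected component of the remaining graph contains at most one cycle (two parallel edges form a cycle). \textbf{Theorem.} Let $\varepsilon>0$ and $0<\delta<1$, let $s\ge 0$ be an integer, and let $c$ be an integer with $c\ge (s+2)/\delta$. There is a constant $C$, depending only on $\varepsilon,\delta,s,c$, such that the following holds for all integers $n\ge1$ and $m\ge(1+\varepsilon)n$, for $\ell=n^\delta$ (rounded down or up to an integer), for every finite set $U$, every 2-universal class $\mathcal F$ of functions $U\to[\ell]$, every 2-wise independent class $\mathcal H$ of functions $U\to[m]$, and every $S\subseteq U$ with $|S|=n$: if $(h_1,h_2)$ is chosen at random from $\mathcal Z^{c,2}_{\ell,m}$ built from $\mathcal F$ and $\mathcal H$, then $$\Pr\bigl(\mathrm{ex}(G(S,h_1,h_2))\ge s+1\bigr)\le \frac{C}{n^{s+1}}.$$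 -/

import Mathlib

open scoped Graph

noncomputable section

namespace CuckooStash

/-- Probability that `P` holds for an element chosen uniformly at random from the
finite nonempty set `A`. -/
def uniformPr {α : Type*} (A : Set α) (P : α → Prop) : ℝ :=
  ({a | a ∈ A ∧ P a}.ncard : ℝ) / (A.ncard : ℝ)

/-- A hash class `A` of functions `U → [m]` is `κ`-universal: any two distinct keys collide
with probability at most `κ / m` under a random function from the class. -/
def IsUniversal {U : Type*} {m : ℕ} (κ : ℝ) (A : Set (U → Fin m)) : Prop :=
  A.Nonempty ∧ ∀ x y : U, x ≠ y → uniformPr A (fun h => h x = h y) ≤ κ / m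

/-- A hash class `A` of functions `U → [m]` is `κ`-wise independent: the values of a random
function from the class on any `κ` distinct keys are uniformly distributed in `[m]^κ`. -/
def IsWiseIndependent {U : Type*} {m : ℕ} (κ : ℕ) (A : Set (U → Fin m)) : Prop :=
  A.Nonempty ∧ ∀ x : Fin κ → U, Function.Injective x → ∀ j : Fin κ → Fin m,
    uniformPr A (fun h => ∀ i, h (x i) = j i) = 1 / (m : ℝ) ^ κ

/-- The components `f₁, …, f_d`, `g₁, …, g_c`, `z⁽¹⁾, …, z⁽ᵈ⁾` of a sequence of `d` hash
functions. -/
@[ext]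
structure HashSeq (U : Type*) (c d ℓ m : ℕ) where
  f : Fin d → U → Fin m
  g : Fin c → U → Fin ℓ
  z : Fin d → Fin c → Fin ℓ → Fin m

/-- `h_i(x) = (f_i(x) + ∑_j z⁽ⁱ⁾[j, g_j(x)]) mod m`. -/
def HashSeq.hash {U : Type*} {c d ℓ m : ℕ} (h : HashSeq U c d ℓ m) (i : Fin d) (x : U) :
    Fin m :=
  ⟨((h.f i x : ℕ) + ∑ j : Fin c, (h.z i j (h.g j x) : ℕ)) % m,
    Nat.mod_lt _ (lt_of_le_of_lt (Nat.zero_le _) (h.f i x).isLt)⟩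

/-- The hash class `Z^{c,d}_{ℓ,m}(F, H)`: the `f`-components come from `H`, the `g`-components
from `F`, and the tables are arbitrary. -/
def hashClassZ {U : Type*} (c d : ℕ) {ℓ m : ℕ} (F : Set (U → Fin ℓ)) (H : Set (U → Fin m)) :
    Set (HashSeq U c d ℓ m) :=
  {h | (∀ i, h.f i ∈ H) ∧ ∀ j, h.g j ∈ F}

/-- The bipartite multigraph `G(S, h₁, h₂)`: the vertices are two copies of `[m]`, and every
key `x ∈ S` is (the label of) an edge between `h₁(x)` in the first copy and `h₂(x)` in the
second copy. -/
def keyGraph {U : Type*} {m : ℕ} (S : Finset U) (h₁ h₂ : U → Fin m) :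
    Graph (Fin m ⊕ Fin m) U where
  vertexSet := Set.univ
  IsLink x v w := x ∈ S ∧
    ((v = Sum.inl (h₁ x) ∧ w = Sum.inr (h₂ x)) ∨ (v = Sum.inr (h₂ x) ∧ w = Sum.inl (h₁ x)))
  edgeSet := {x | x ∈ S}
  isLink_symm := by
    intro e _
    constructor
    rintro x y ⟨hS, h⟩
    exact ⟨hS, by tauto⟩
  eq_or_eq_of_isLink_of_isLink := by
    rintro e x y v w ⟨_, h⟩ ⟨_, h'⟩
    rcases h with ⟨rfl, rfl⟩ | ⟨rfl, rfl⟩ <;> rcases h' with ⟨rfl, rfl⟩ | ⟨rfl, rfl⟩ <;> simp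
  edge_mem_iff_exists_isLink := by
    intro e
    constructor
    · intro he
      exact ⟨_, _, he, Or.inl ⟨rfl, rfl⟩⟩
    · rintro ⟨_, _, he, _⟩
      exact he
  left_mem_of_isLink := by
    intro _ _ _ _
    exact Set.mem_univ _

/-- `D` is the edge set of a cycle `v₀, e₀, v₁, e₁, …, v_k, e_k, v₀` of the multigraph `G`, with
distinct vertices and distinct edges. (Indices in `Fin (k + 1)` wrap around; a loop is a cycle
of length 1, and two parallel edges form a cycle of length 2.) -/
def IsCycleEdgeSet {α β : Type*} (G : Graph α β) (D : Set β) : Prop :=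
  ∃ (k : ℕ) (v : Fin (k + 1) → α) (e : Fin (k + 1) → β),
    Function.Injective v ∧ Function.Injective e ∧
      (∀ i, G.IsLink (e i) (v i) (v (i + 1))) ∧ D = Set.range e

/-- The edges of the connected component of `G` that contains the vertex `x`. -/
def componentEdges {α β : Type*} (G : Graph α β) (x : α) : Set β :=
  {e | ∃ y, Relation.ReflTransGen G.Adj x y ∧ G.Inc e y}

/-- Every connected component of `G` is acyclic (has no cycle) or unicyclic (has exactly one
cycle). -/
def ComponentsAcyclicOrUnicyclic {α β : Type*} (G : Graph α β) : Prop :=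
  ∀ x ∈ V(G),
    (¬ ∃ D, IsCycleEdgeSet G D ∧ D ⊆ componentEdges G x) ∨
      (∃! D, IsCycleEdgeSet G D ∧ D ⊆ componentEdges G x)

/-- The excess of a multigraph with finitely many edges: the minimum number of edges whose
removal leaves only acyclic and unicyclic connected components. -/
def excess {α β : Type*} (G : Graph α β) : ℕ :=
  sInf {k | ∃ R : Finset β, (R : Set β) ⊆ E(G) ∧ R.card = k ∧
    ComponentsAcyclicOrUnicyclic (G.deleteEdges (R : Set β))}

end CuckooStash

end

/-! Hall's theorem with `s` dummy vertices turns excess at least `s + 1` into a set of keys with at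
least `s + 1` more edges than vertices (`exists_spanCard_add_le_card`). A minimal such set has no
leaves, so it can be explored by walks that go on until they hit the explored part. Counting
coincidences of ends minus keys, every closed walk gains one, and every start at a fresh key loses
one. `exists_exploration` stops at a list of `t` keys with `t + s + 1` coincidences.

The union bound runs over the list (at most `n ^ t` choices) and the pattern of coincidences.
Continuing a walk involves no choice, and at most `5 * (s + 1)` steps are of another kind, so the
number of patterns is polynomial in `t`; an exponential number could outweigh the decay of `(n / m)
^ t`. Under fully random functions a pattern has probability at most `m ^ (-(t + s + 1))`, and the
sum of `poly(t) * (n / m) ^ t / m ^ (s + 1)` is `O(n ^ (-(s + 1)))`.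

For the given class, fix the `g j`. If some `g j` has at most one collision on the list, its table
rows and the pairwise independence of the `f i` make every pattern at most as probable as the fully
random bound (`card_hash_eq_mul_le`, `card_sat_hash_mul_le`). Otherwise the newest keys are removed
until this first holds. Removing one key destroys at most one collision of each `g j`, so on the
remaining `t` keys all `g j` still collide, which has probability at most `(2 * t ^ 2 / ℓ) ^ c =
poly(t) * O(n ^ (-(s + 2)))`. Every tail of an exploration has at least `t - 1` coincidences, so the
union bound loses only one factor `n`, and `n ^ (-(s + 1))` remains. -/

noncomputable section

namespace CuckooStash

/-! ### Graphs whose edges can be assigned injectively to ends -/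

section Pseudoforest

variable {α β : Type*} (G : Graph α β) (φ : β → α)

open Classical in
/-- If every edge of `G` is assigned to one of its ends, this is the end of the edge assigned to
`a` opposite to `a`, or `a` itself if there is no such edge. -/
def succVertex (a : α) : α :=
  if h : ∃ b e, G.IsLink e a b ∧ φ e = a then h.choose else a

variable {G φ}

lemma succVertex_eq (hφ : Set.InjOn φ E(G)) {e : β} {a b : α} (h : G.IsLink e a b)
    (he : φ e = a) : succVertex G φ a = b := by
  have hex : ∃ b e, G.IsLink e a b ∧ φ e = a := ⟨b, e, h, he⟩
  obtain ⟨e', h', he'⟩ := hex.choose_spec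
  have : e' = e := hφ h'.edge_mem h.edge_mem (he'.trans he.symm)
  subst this
  rw [succVertex, dif_pos hex]
  exact h'.right_unique h

/-- Every edge joins its assigned end to the successor of that end, so adjacent vertices have
merging orbits. Hence a component has only one eventual orbit. -/
lemma exists_iterate_succVertex_eq (hφ : Set.InjOn φ E(G)) (hinc : ∀ e ∈ E(G), G.Inc e (φ e))
    {x y : α} (h : Relation.ReflTransGen G.Adj x y) :
    ∃ i j, (succVertex G φ)^[i] x = (succVertex G φ)^[j] y := by
  induction h with
  | refl => exact ⟨0, 0, rfl⟩
  | @tail y z _ hyz ih =>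
    obtain ⟨i, j, hij⟩ := ih
    obtain ⟨e, he⟩ := hyz
    rcases (hinc e he.edge_mem).eq_or_eq_of_isLink he with h1 | h1
    · have h2 := succVertex_eq hφ he h1
      refine ⟨i + 1, j, ?_⟩
      rw [Function.iterate_succ_apply', hij, ← Function.iterate_succ_apply' (succVertex G φ),
        Function.iterate_succ_apply, h2]
    · have h2 := succVertex_eq hφ he.symm h1
      refine ⟨i, j + 1, ?_⟩
      rw [hij, Function.iterate_succ_apply, h2]

section Cycle

variable {k : ℕ} {v : Fin (k + 1) → α} {e : Fin (k + 1) → β}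

/-- A cycle has as many edges as vertices, so the injective assignment restricted to it is a
bijection. -/
lemma exists_perm_of_cycle (hφ : Set.InjOn φ E(G)) (hinc : ∀ e ∈ E(G), G.Inc e (φ e))
    (he : Function.Injective e)
    (hl : ∀ i, G.IsLink (e i) (v i) (v (i + 1))) :
    ∃ σ : Equiv.Perm (Fin (k + 1)), ∀ i, φ (e i) = v (σ i) := by
  have h1 : ∀ i, ∃ j, φ (e i) = v j := fun i => by
    rcases (hinc _ (hl i).edge_mem).eq_or_eq_of_isLink (hl i) with h | h
    exacts [⟨_, h⟩, ⟨_, h⟩]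
  choose σ hσ using h1
  have hinj : Function.Injective σ := fun i j hij => he <|
    hφ (hl i).edge_mem (hl j).edge_mem (by rw [hσ, hσ, hij])
  exact ⟨Equiv.ofBijective σ (Finite.injective_iff_bijective.1 hinj), hσ⟩

lemma range_eq_of_cycle (hφ : Set.InjOn φ E(G)) (hinc : ∀ e ∈ E(G), G.Inc e (φ e))
    (he : Function.Injective e)
    (hl : ∀ i, G.IsLink (e i) (v i) (v (i + 1))) :
    Set.range e = {x | x ∈ E(G) ∧ φ x ∈ Set.range v} := by
  obtain ⟨σ, hσ⟩ := exists_perm_of_cycle hφ hinc he hl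
  ext x
  constructor
  · rintro ⟨i, rfl⟩
    exact ⟨(hl i).edge_mem, _, (hσ i).symm⟩
  · rintro ⟨hx, i, hi⟩
    refine ⟨σ.symm i, hφ (hl _).edge_mem hx ?_⟩
    rw [hσ, Equiv.apply_symm_apply, hi]

lemma succVertex_mem_range (hφ : Set.InjOn φ E(G)) (hinc : ∀ e ∈ E(G), G.Inc e (φ e))
    (he : Function.Injective e)
    (hl : ∀ i, G.IsLink (e i) (v i) (v (i + 1))) {a : α} (ha : a ∈ Set.range v) :
    succVertex G φ a ∈ Set.range v := by
  obtain ⟨σ, hσ⟩ := exists_perm_of_cycle hφ hinc he hl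
  obtain ⟨i, rfl⟩ := ha
  have h1 : φ (e (σ.symm i)) = v i := by rw [hσ, Equiv.apply_symm_apply]
  have h2 := hl (σ.symm i)
  rcases (hinc _ h2.edge_mem).eq_or_eq_of_isLink h2 with h | h
  · rw [← h1, h, succVertex_eq hφ h2 h]
    exact ⟨_, rfl⟩
  · rw [← h1, h, succVertex_eq hφ h2.symm h]
    exact ⟨_, rfl⟩

/-- If a vertex of the cycle lies in `W`, so do both ends of the cycle edge assigned to it. This
propagates around the cycle in both possible orientations. -/
lemma range_subset_of_closed (hφ : Set.InjOn φ E(G)) (hinc : ∀ e ∈ E(G), G.Inc e (φ e))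
    (he : Function.Injective e)
    (hl : ∀ i, G.IsLink (e i) (v i) (v (i + 1))) {W : Set α}
    (hne : ∃ i, v i ∈ W) (hcl : ∀ a ∈ W, succVertex G φ a ∈ W) : Set.range v ⊆ W := by
  obtain ⟨σ, hσ⟩ := exists_perm_of_cycle hφ hinc he hl
  have key : ∀ i, v i ∈ W → v (σ.symm i) ∈ W ∧ v (σ.symm i + 1) ∈ W := by
    intro i hi
    have h1 : φ (e (σ.symm i)) = v i := by rw [hσ, Equiv.apply_symm_apply]
    have h2 := hl (σ.symm i)
    rcases (hinc _ h2.edge_mem).eq_or_eq_of_isLink h2 with h | h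
    · have h3 := succVertex_eq hφ h2 h
      rw [← h3, ← h, h1]
      exact ⟨hi, hcl _ hi⟩
    · have h3 := succVertex_eq hφ h2.symm h
      rw [← h3, ← h, h1]
      exact ⟨hcl _ hi, hi⟩
  -- `σ.symm` maps the finite set of indices with `v i ∈ W` injectively, hence onto, itself, so `σ`
  -- preserves it too.
  have hσW : ∀ i, v i ∈ W → v (σ i) ∈ W := by
    let τ : {i // v i ∈ W} → {i // v i ∈ W} := fun i => ⟨σ.symm i, (key i i.2).1⟩
    have hτ : Function.Surjective τ := Finite.surjective_of_injective fun i j hij =>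
      Subtype.ext (σ.symm.injective (congrArg Subtype.val hij))
    intro i hi
    obtain ⟨j, hj⟩ := hτ ⟨i, hi⟩
    have hji : σ.symm j = i := congrArg Subtype.val hj
    rw [← hji, Equiv.apply_symm_apply]
    exact j.2
  have hsucc : ∀ i, v i ∈ W → v (i + 1) ∈ W := fun i hi => by
    simpa using (key (σ i) (hσW i hi)).2
  obtain ⟨i₀, h₀⟩ := hne
  have hall : ∀ j : Fin (k + 1), v (i₀ + j) ∈ W := by
    intro j
    induction j using Fin.induction with
    | zero => simpa using h₀
    | succ j ih => simpa [add_assoc] using hsucc _ ih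
  rintro _ ⟨i, rfl⟩
  simpa using hall (i - i₀)

end Cycle

/-- If the edges of a multigraph can be assigned injectively to their ends, then no component
has two cycles. -/
lemma componentsAcyclicOrUnicyclic_of_injOn (hφ : Set.InjOn φ E(G))
    (hinc : ∀ e ∈ E(G), G.Inc e (φ e)) : ComponentsAcyclicOrUnicyclic G := by
  intro x _
  by_cases hD : ∃ D, IsCycleEdgeSet G D ∧ D ⊆ componentEdges G x
  swap
  · exact Or.inl hD
  right
  refine existsUnique_of_exists_of_unique hD ?_
  rintro D D' ⟨⟨k, v, e, -, he, hl, rfl⟩, hc⟩ ⟨⟨k', v', e', -, he', hl', rfl⟩, hc'⟩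
  have reach : ∀ {k : ℕ} {v : Fin (k + 1) → α} {e : Fin (k + 1) → β},
      (∀ i, G.IsLink (e i) (v i) (v (i + 1))) → Set.range e ⊆ componentEdges G x →
      ∃ i, Relation.ReflTransGen G.Adj x (v i) := by
    intro k v e hl hc
    obtain ⟨y, hy, hi⟩ := hc ⟨0, rfl⟩
    rcases hi.eq_or_eq_of_isLink (hl 0) with h | h
    · exact ⟨_, h ▸ hy⟩
    · exact ⟨_, h ▸ hy⟩
  obtain ⟨i, hi⟩ := reach hl hc
  obtain ⟨i', hi'⟩ := reach hl' hc'
  have hsymm : Relation.ReflTransGen G.Adj (v i) x :=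
    (Relation.ReflTransGen.stdSymm (r := G.Adj)).symm _ _ hi
  obtain ⟨a, b, hab⟩ := exists_iterate_succVertex_eq hφ hinc (hsymm.trans hi')
  have it : ∀ {k : ℕ} {v : Fin (k + 1) → α} {e : Fin (k + 1) → β}, Function.Injective e →
      (∀ i, G.IsLink (e i) (v i) (v (i + 1))) → ∀ i (n : ℕ),
      (succVertex G φ)^[n] (v i) ∈ Set.range v := by
    intro k v e he hl i n
    induction n with
    | zero => exact ⟨i, rfl⟩
    | succ n ih =>
      rw [Function.iterate_succ_apply']
      exact succVertex_mem_range hφ hinc he hl ih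
  obtain ⟨p, hp⟩ := it he hl i a
  obtain ⟨p', hp'⟩ := it he' hl' i' b
  have hpp : v p = v' p' := by rw [hp, hp', hab]
  -- The orbits from the two cycles meet, so their vertex sets intersect. The intersection is closed
  -- under successors and therefore contains both cycles.
  have hcl : ∀ a ∈ Set.range v ∩ Set.range v', succVertex G φ a ∈ Set.range v ∩ Set.range v' :=
    fun a ha => ⟨succVertex_mem_range hφ hinc he hl ha.1,
      succVertex_mem_range hφ hinc he' hl' ha.2⟩
  have h1 := range_subset_of_closed hφ hinc he hl (W := Set.range v ∩ Set.range v')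
    ⟨p, ⟨p, rfl⟩, p', hpp.symm⟩ hcl
  have h2 := range_subset_of_closed hφ hinc he' hl' (W := Set.range v ∩ Set.range v')
    ⟨p', ⟨p, hpp⟩, p', rfl⟩ hcl
  have hvv : Set.range v = Set.range v' :=
    Set.Subset.antisymm (fun a ha => (h1 ha).2) (fun a ha => (h2 ha).1)
  rw [range_eq_of_cycle hφ hinc he hl, range_eq_of_cycle hφ hinc he' hl', hvv]

end Pseudoforest

/-! ### Hall's theorem: large excess gives a dense set of keys -/

section Hall

variable {U : Type*} {m : ℕ}

open Classical in
/-- The number of vertices of the subgraph of the key graph that is spanned by the keys in `A`. -/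
def spanCard (h : Fin 2 → U → Fin m) (A : Finset U) : ℕ :=
  ∑ b, (A.image (h b)).card

/-- A key graph of large excess has a subset of keys that spans few vertices. -/
lemma exists_spanCard_add_le_card (h : Fin 2 → U → Fin m) (S : Finset U) (s : ℕ)
    (hex : s + 1 ≤ excess (keyGraph S (h 0) (h 1))) :
    ∃ A ⊆ S, spanCard h A + s + 1 ≤ A.card := by
  classical
  by_contra! hA
  -- Each key may be matched to one of its two ends or to one of `s` dummies; a nonempty set of keys
  -- sees all dummies.
  let t : S → Finset ((Fin m ⊕ Fin m) ⊕ Fin s) := fun x =>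
    {Sum.inl (Sum.inl (h 0 x)), Sum.inl (Sum.inr (h 1 x))} ∪ Finset.univ.image Sum.inr
  have hall : ∀ A : Finset S, A.card ≤ (A.biUnion t).card := by
    intro A
    rcases A.eq_empty_or_nonempty with rfl | ⟨a, ha⟩
    · simp
    have h1 := hA (A.image Subtype.val) (by intro x; simp; tauto)
    rw [Finset.card_image_of_injective _ Subtype.val_injective] at h1
    have h2 : spanCard h (A.image Subtype.val) + s ≤ (A.biUnion t).card := by
      let B : Finset ((Fin m ⊕ Fin m) ⊕ Fin s) :=
        (((A.image Subtype.val).image (h 0)).disjSum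
          ((A.image Subtype.val).image (h 1))).disjSum Finset.univ
      have hB : B ⊆ A.biUnion t := by
        intro y hy
        rw [Finset.mem_biUnion]
        rcases y with (y | y) | y
        · simp only [B, Finset.inl_mem_disjSum, Finset.mem_image] at hy
          obtain ⟨_, ⟨x, hx, rfl⟩, rfl⟩ := hy
          exact ⟨x, hx, by simp [t]⟩
        · simp only [B, Finset.inl_mem_disjSum, Finset.inr_mem_disjSum, Finset.mem_image] at hy
          obtain ⟨_, ⟨x, hx, rfl⟩, rfl⟩ := hy
          exact ⟨x, hx, by simp [t]⟩
        · exact ⟨a, ha, by simp [t]⟩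
      have := Finset.card_le_card hB
      simpa [B, Finset.card_disjSum, spanCard, Fin.sum_univ_two] using this
    omega
  obtain ⟨f, hf, hft⟩ := (Finset.all_card_le_biUnion_card_iff_exists_injective t).1 hall
  -- The keys matched to dummies are deleted; the others are assigned injectively to their ends.
  let R : Finset U := (Finset.univ.filter fun x : S => (f x).isRight).image Subtype.val
  have hRS : R ⊆ S := by intro x; simp [R]; tauto
  have hRcard : R.card ≤ s := by
    rw [Finset.card_image_of_injective _ Subtype.val_injective]
    have h1 : ((Finset.univ.filter fun x : S => (f x).isRight).image f) ⊆
        Finset.univ.image Sum.inr := by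
      intro y hy
      simp only [Finset.mem_image, Finset.mem_filter, Finset.mem_univ, true_and] at hy ⊢
      obtain ⟨x, hx, rfl⟩ := hy
      obtain ⟨z, hz⟩ := Sum.isRight_iff.1 hx
      exact ⟨z, hz.symm⟩
    have h2 := Finset.card_le_card h1
    rw [Finset.card_image_of_injective _ hf,
      Finset.card_image_of_injective _ Sum.inr_injective] at h2
    simpa using h2
  have hbad : excess (keyGraph S (h 0) (h 1)) ≤ R.card := by
    refine Nat.sInf_le ⟨R, fun x hx => hRS hx, rfl, ?_⟩
    let φ : U → Fin m ⊕ Fin m := fun x =>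
      if hx : x ∈ S then (f ⟨x, hx⟩).elim id (fun _ => Sum.inl (h 0 x)) else Sum.inl (h 0 x)
    have hφ : ∀ x (hx : x ∈ S), x ∉ R → f ⟨x, hx⟩ = Sum.inl (φ x) := by
      intro x hx hxR
      have : ¬ (f ⟨x, hx⟩).isRight := by
        intro hr
        exact hxR (Finset.mem_image.2 ⟨⟨x, hx⟩, by simpa using hr, rfl⟩)
      rcases hfx : f ⟨x, hx⟩ with y | y
      · simp [φ, hx, hfx]
      · simp [hfx] at this
    have hE : ∀ x ∈ E((keyGraph S (h 0) (h 1)).deleteEdges (R : Set U)), x ∈ S ∧ x ∉ R := by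
      intro x hx
      rw [Graph.edgeSet_deleteEdges] at hx
      exact ⟨hx.1, by simpa using hx.2⟩
    refine componentsAcyclicOrUnicyclic_of_injOn (φ := φ) ?_ ?_
    · intro x hx y hy hxy
      obtain ⟨hx, hxR⟩ := hE x hx
      obtain ⟨hy, hyR⟩ := hE y hy
      have := hf ((hφ x hx hxR).trans ((congrArg _ hxy).trans (hφ y hy hyR).symm))
      simpa using this
    · intro x hx
      obtain ⟨hx, hxR⟩ := hE x hx
      rw [Graph.deleteEdges_inc]
      refine ⟨?_, by simpa using hxR⟩
      have h1 := hft ⟨x, hx⟩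
      rw [hφ x hx hxR] at h1
      simp only [t, Finset.mem_union, Finset.mem_insert, Finset.mem_singleton, Finset.mem_image,
        Sum.inl.injEq, reduceCtorEq, and_false, exists_false, or_false] at h1
      rcases h1 with h1 | h1
      · rw [h1]
        exact ⟨_, hx, Or.inl ⟨rfl, rfl⟩⟩
      · rw [h1]
        exact ⟨_, hx, Or.inr ⟨rfl, rfl⟩⟩
  omega

end Hall

/-! ### Exploring a dense set of keys by walks -/

section Exploration

/-- An instruction describes how a new key is attached to a list of earlier keys in the key graph.
`none` means that the key continues a walk: it shares with the previous key the end at which the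
previous key was not attached. `some (b, o, o')` means that its end on side `b` (on side `b + 1`)
agrees with the end of the earlier key number `o` (number `o'`), if such a number is given. -/
abbrev Instr := Option (Fin 2 × Option ℕ × Option ℕ)

/-- The side at which the newest key was attached. -/
def attachSide : List Instr → Fin 2
  | [] => 0
  | none :: c => attachSide c + 1
  | some y :: _ => y.1

/-- The explicit form of an instruction, given the earlier ones. -/
def resolve (c : List Instr) : Instr → Fin 2 × Option ℕ × Option ℕ
  | none => (attachSide c + 1, some 0, none)
  | some y => y

/-- The number of coincidences that an instruction prescribes. -/
def instrWeight : Instr → ℕ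
  | none => 1
  | some y => (if y.2.1.isSome then 1 else 0) + (if y.2.2.isSome then 1 else 0)

lemma instrWeight_eq (c : List Instr) (i : Instr) :
    instrWeight i = (if (resolve c i).2.1.isSome then 1 else 0) +
      (if (resolve c i).2.2.isSome then 1 else 0) := by
  cases i <;> rfl

/-- The number of coincidences that a list of instructions prescribes. -/
def weight (c : List Instr) : ℕ := (c.map instrWeight).sum

@[simp] lemma weight_nil : weight [] = 0 := rfl

@[simp] lemma weight_cons (i : Instr) (c : List Instr) :
    weight (i :: c) = instrWeight i + weight c := by
  simp [weight]

/-- The number of instructions that do not just continue a walk. -/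
def jumps (c : List Instr) : ℕ := c.countP Option.isSome

@[simp] lemma jumps_nil : jumps [] = 0 := rfl

@[simp] lemma jumps_cons_none (c : List Instr) : jumps (none :: c) = jumps c := by
  simp [jumps]

@[simp] lemma jumps_cons_some (y) (c : List Instr) : jumps (some y :: c) = jumps c + 1 := by
  simp [jumps]

variable {U : Type*} {m : ℕ}

/-- The end of `x` on side `b` agrees with the end of the entry of `L` with number `o`,
if a number is given. -/
def Attached (h : Fin 2 → U → Fin m) (L : List U) (x : U) (b : Fin 2) (o : Option ℕ) : Prop :=
  ∀ j ∈ o, ∃ y, L[j]? = some y ∧ h b x = h b y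

/-- The keys in `L`, newest first, are attached as the instructions prescribe. -/
def Sat (h : Fin 2 → U → Fin m) : List Instr → List U → Prop
  | [], [] => True
  | i :: c, x :: L => Sat h c L ∧ Attached h L x (resolve c i).1 (resolve c i).2.1 ∧
      Attached h L x ((resolve c i).1 + 1) (resolve c i).2.2
  | _, _ => False

lemma Sat.length_eq {h : Fin 2 → U → Fin m} : ∀ {c : List Instr} {L : List U},
    Sat h c L → c.length = L.length
  | [], [], _ => rfl
  | _ :: _, _ :: _, hs => by simp [Sat.length_eq hs.1]
  | [], _ :: _, hs => hs.elim
  | _ :: _, [], hs => hs.elim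

/-- Some entry of `L` has the same end on side `b` as `x`. -/
def Touches (h : Fin 2 → U → Fin m) (L : List U) (b : Fin 2) (x : U) : Prop :=
  ∃ z ∈ L, h b z = h b x

lemma Touches.exists_attached {h : Fin 2 → U → Fin m} {L : List U} {b : Fin 2} {x : U}
    (ht : Touches h L b x) : ∃ j, Attached h L x b (some j) := by
  obtain ⟨z, hz, hzx⟩ := ht
  obtain ⟨j, hj, rfl⟩ := List.mem_iff_getElem.1 hz
  refine ⟨j, fun j' hj' => ?_⟩
  obtain rfl : j = j' := by simpa using hj'
  exact ⟨L[j], by simp [hj], hzx.symm⟩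

lemma attached_none (h : Fin 2 → U → Fin m) (L : List U) (x : U) (b : Fin 2) :
    Attached h L x b none := by
  simp [Attached]

lemma sum_side {M : Type*} [AddCommMonoid M] (f : Fin 2 → M) (b : Fin 2) :
    ∑ b', f b' = f b + f (b + 1) := by
  rw [Fin.sum_univ_two]
  fin_cases b
  · rfl
  · exact add_comm _ _

lemma side_eq_or (b b' : Fin 2) : b' = b ∨ b' = b + 1 := by
  fin_cases b <;> fin_cases b' <;> simp

open Classical in
lemma spanCard_cons (h : Fin 2 → U → Fin m) (L : List U) (x : U) (b : Fin 2) :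
    spanCard h (x :: L).toFinset = spanCard h L.toFinset +
      ((if Touches h L b x then 0 else 1) + (if Touches h L (b + 1) x then 0 else 1)) := by
  have key : ∀ b, ((x :: L).toFinset.image (h b)).card =
      (L.toFinset.image (h b)).card + (if Touches h L b x then 0 else 1) := by
    intro b
    rw [List.toFinset_cons, Finset.image_insert]
    by_cases ht : Touches h L b x
    · rw [if_pos ht, Finset.insert_eq_of_mem]
      · rfl
      · obtain ⟨z, hz, hzx⟩ := ht
        exact Finset.mem_image.2 ⟨z, by simpa using hz, hzx⟩
    · rw [if_neg ht, Finset.card_insert_of_notMem]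
      intro hm
      obtain ⟨z, hz, hzx⟩ := Finset.mem_image.1 hm
      exact ht ⟨z, by simpa using hz, hzx⟩
  unfold spanCard
  rw [Finset.sum_congr rfl fun b _ => key b, Finset.sum_add_distrib,
    sum_side (fun b => if Touches h L b x then 0 else 1) b]

open Classical in
/-- The list `L` of keys from `A` has been explored by following the instructions `c`: exactly
the prescribed coincidences occurred, and at no time did the number of keys exceed
the number of coincidences by more than one. -/
structure Exploration (h : Fin 2 → U → Fin m) (A : Finset U) (c : List Instr) (L : List U) :
    Prop where
  sat : Sat h c L
  nodup : L.Nodup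
  mem : ∀ x ∈ L, x ∈ A
  balance : 2 * L.length = weight c + spanCard h L.toFinset
  tails : ∀ c', c' <:+ c → c'.length ≤ weight c' + 1

variable {h : Fin 2 → U → Fin m} {A : Finset U}

lemma Exploration.nil : Exploration h A [] [] where
  sat := trivial
  nodup := List.nodup_nil
  mem := by simp
  balance := by simp [spanCard]
  tails := by simp

lemma Exploration.cons {c : List Instr} {L : List U} (hE : Exploration h A c L) {x : U}
    (hxA : x ∈ A) (hxL : x ∉ L) (i : Instr)
    (h1 : Attached h L x (resolve c i).1 (resolve c i).2.1)
    (h2 : Attached h L x ((resolve c i).1 + 1) (resolve c i).2.2)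
    (ht1 : (resolve c i).2.1.isSome ↔ Touches h L (resolve c i).1 x)
    (ht2 : (resolve c i).2.2.isSome ↔ Touches h L ((resolve c i).1 + 1) x)
    (hlen : L.length ≤ instrWeight i + weight c) : Exploration h A (i :: c) (x :: L) where
  sat := ⟨hE.sat, h1, h2⟩
  nodup := List.nodup_cons.2 ⟨hxL, hE.nodup⟩
  mem := by
    intro y hy
    rcases List.mem_cons.1 hy with rfl | hy
    exacts [hxA, hE.mem y hy]
  balance := by
    classical
    rw [spanCard_cons h L x (resolve c i).1, weight_cons, instrWeight_eq c i]
    have := hE.balance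
    simp only [List.length_cons]
    have e1 : (if (resolve c i).2.1.isSome then 1 else 0) =
        if Touches h L (resolve c i).1 x then 1 else 0 := by
      simp only [ht1]
    have e2 : (if (resolve c i).2.2.isSome then 1 else 0) =
        if Touches h L ((resolve c i).1 + 1) x then 1 else 0 := by
      simp only [ht2]
    rw [e1, e2]
    split_ifs <;> omega
  tails := by
    intro c' hc'
    rcases List.suffix_cons_iff.1 hc' with rfl | hc'
    · rw [List.length_cons, hE.sat.length_eq, weight_cons]
      omega
    · exact hE.tails c' hc'

/-- In a graph without leaves, a walk can be continued until it returns to an explored vertex. -/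
lemma Exploration.exists_walk (hA : ∀ x ∈ A, ∀ b, ∃ y ∈ A, y ≠ x ∧ h b y = h b x) :
    ∀ (n : ℕ) (c : List Instr) (L : List U) (x : U) (k : ℕ), A.card ≤ L.length + n →
      Exploration h A c (x :: L) → ¬ Touches h L (attachSide c + 1) x →
      (x :: L).length + k = weight c + 1 →
      ∃ c' L', Exploration h A c' L' ∧ x :: L <:+ L' ∧ L'.length + k = weight c' ∧
        jumps c' ≤ jumps c + 1 := by
  classical
  -- Induction on a bound for the unexplored keys. The surplus of coincidences over keys is `k - 1`
  -- while the walk is open and `k` once it is closed.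
  intro n
  induction n with
  | zero =>
    intro c L x k hn hE
    exfalso
    have h1 := Finset.card_le_card (s := (x :: L).toFinset) (t := A)
      (fun y hy => hE.mem y (by simpa using hy))
    rw [List.toFinset_card_of_nodup hE.nodup] at h1
    simp at h1
    omega
  | succ n ih =>
    intro c L x k hn hE hfresh hk
    obtain ⟨y, hyA, hyx, hy⟩ := hA x (hE.mem x (by simp)) (attachSide c + 1)
    have hyL : y ∉ x :: L := by
      intro hm
      rcases List.mem_cons.1 hm with rfl | hm
      · exact hyx rfl
      · exact hfresh ⟨y, hm, hy⟩
    have hatt : Attached h (x :: L) y (attachSide c + 1) (some 0) := by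
      intro j hj
      obtain rfl : 0 = j := by simpa using hj
      exact ⟨x, by simp, hy⟩
    have htouch : Touches h (x :: L) (attachSide c + 1) y := ⟨x, by simp, hy.symm⟩
    -- If the far end of `y` is already explored, the walk closes with two coincidences; otherwise
    -- `y` continues it at the price of one.
    by_cases ht : Touches h (x :: L) (attachSide c + 1 + 1) y
    · obtain ⟨j, hj⟩ := ht.exists_attached
      have hE' := hE.cons hyA hyL (some (attachSide c + 1, some 0, some j)) hatt hj
        (by simpa [resolve] using htouch) (by simpa [resolve] using ht)
        (by simp [instrWeight] at hk ⊢; omega)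
      refine ⟨_, _, hE', List.suffix_cons _ _, ?_, by simp⟩
      simp [instrWeight] at hk ⊢
      omega
    · have hE' := hE.cons hyA hyL none hatt (attached_none _ _ _ _)
        (by simpa [resolve] using htouch) (by simpa [resolve] using ht)
        (by simp [instrWeight] at hk ⊢; omega)
      obtain ⟨c', L', hE'', hs, hk', hj⟩ := ih (none :: c) (x :: L) y k
        (by simp; omega) hE' (by simpa [attachSide] using ht)
        (by simp [instrWeight] at hk ⊢; omega)
      exact ⟨c', L', hE'', (List.suffix_cons _ _).trans hs, hk', by simpa using hj⟩

/-- An unexplored key that touches the explored part starts a walk that returns to it. -/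
lemma Exploration.exists_ear (hA : ∀ x ∈ A, ∀ b, ∃ y ∈ A, y ≠ x ∧ h b y = h b x)
    {c : List Instr} {L : List U} (hE : Exploration h A c L) {x : U} (hxA : x ∈ A)
    (hxL : x ∉ L) {b : Fin 2} (ht : Touches h L b x) {k : ℕ} (hk : L.length + k = weight c + 1) :
    ∃ c' L', Exploration h A c' L' ∧ L <:+ L' ∧ L.length < L'.length ∧
      L'.length + k = weight c' ∧ jumps c' ≤ jumps c + 2 := by
  obtain ⟨j, hj⟩ := ht.exists_attached
  by_cases ht' : Touches h L (b + 1) x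
  · obtain ⟨j', hj'⟩ := ht'.exists_attached
    have hE' := hE.cons hxA hxL (some (b, some j, some j')) hj hj'
      (by simpa [resolve] using ht) (by simpa [resolve] using ht')
      (by simp [instrWeight]; omega)
    refine ⟨_, _, hE', List.suffix_cons _ _, by simp, ?_, by simp⟩
    simp [instrWeight]
    omega
  · have hE' := hE.cons hxA hxL (some (b, some j, none)) hj (attached_none _ _ _ _)
      (by simpa [resolve] using ht) (by simpa [resolve] using ht')
      (by simp [instrWeight]; omega)
    obtain ⟨c', L', hE'', hs, hk', hj⟩ := exists_walk hA A.card _ L x k (by omega) hE'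
      (by simpa [attachSide] using ht') (by simp [instrWeight]; omega)
    refine ⟨c', L', hE'', (List.suffix_cons _ _).trans hs, ?_, hk', by simpa using hj⟩
    have := hs.length_le
    simp at this
    omega

/-- A minimal set of keys that spans few vertices has no leaves. -/
lemma exists_ne_of_minimal {s : ℕ} (hcard : spanCard h A + s + 1 ≤ A.card)
    (hmin : ∀ B ⊂ A, B.card < spanCard h B + s + 1) :
    ∀ x ∈ A, ∀ b, ∃ y ∈ A, y ≠ x ∧ h b y = h b x := by
  classical
  intro x hx b
  by_contra! hne
  have h1 := hmin _ (Finset.erase_ssubset hx)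
  rw [Finset.card_erase_of_mem hx] at h1
  have h2 : spanCard h (A.erase x) + 1 ≤ spanCard h A := by
    unfold spanCard
    rw [sum_side _ b, sum_side _ b]
    have h3 : ((A.erase x).image (h b)).card + 1 ≤ (A.image (h b)).card := by
      apply Finset.card_lt_card
      refine (Finset.ssubset_iff_of_subset
        (Finset.image_subset_image (Finset.erase_subset _ _))).2
        ⟨h b x, Finset.mem_image_of_mem _ hx, ?_⟩
      intro hm
      obtain ⟨y, hy, hyx⟩ := Finset.mem_image.1 hm
      exact hne y (Finset.mem_of_mem_erase hy) (Finset.ne_of_mem_erase hy) hyx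
    have h4 := Finset.card_le_card
      (Finset.image_subset_image (f := h (b + 1)) (Finset.erase_subset x A))
    omega
  have h5 : 0 < A.card := Finset.card_pos.2 ⟨x, hx⟩
  omega

/-- If an unexplored key touches `L`, one ear raises the surplus. Otherwise a new component is
entered: the fresh key loses one, and two ears gain two, with at most `1 + 2 + 2` jumps. The second
ear exists because a component with no more keys than vertices could be dropped from a minimal set.
-/
lemma Exploration.exists_progress {s : ℕ} (hcard : spanCard h A + s + 1 ≤ A.card)
    (hmin : ∀ B ⊂ A, B.card < spanCard h B + s + 1) {c : List Instr} {L : List U} {k : ℕ}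
    (hE : Exploration h A c L) (hk : L.length + k = weight c) (hks : k ≤ s) :
    ∃ c' L', Exploration h A c' L' ∧ L'.length + (k + 1) = weight c' ∧
      jumps c' ≤ jumps c + 5 := by
  classical
  have hA := exists_ne_of_minimal hcard hmin
  by_cases ht : ∃ x ∈ A, x ∉ L ∧ ∃ b, Touches h L b x
  · obtain ⟨x, hxA, hxL, b, ht⟩ := ht
    obtain ⟨c', L', hE', -, -, hk', hj⟩ := hE.exists_ear hA hxA hxL ht (k := k + 1) (by omega)
    exact ⟨c', L', hE', hk', by omega⟩
  push Not at ht
  -- If `L` exhausted `A`, the balance equation would give `A.card = spanCard h A + k` with `k ≤ s`.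
  have hx : ∃ x ∈ A, x ∉ L := by
    by_contra! hall
    have hLA : L.toFinset = A := by
      ext x
      rw [List.mem_toFinset]
      exact ⟨hE.mem x, hall x⟩
    have h1 := hE.balance
    rw [hLA] at h1
    have h2 := List.toFinset_card_of_nodup hE.nodup
    rw [hLA] at h2
    omega
  obtain ⟨x, hxA, hxL⟩ := hx
  have hE1 := hE.cons hxA hxL (some (0, none, none)) (attached_none _ _ _ _)
    (attached_none _ _ _ _) (by simpa [resolve] using ht x hxA hxL 0)
    (by simpa [resolve] using ht x hxA hxL 1) (by simp [instrWeight]; omega)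
  obtain ⟨y, hyA, hyx, hy⟩ := hA x hxA 0
  have hyL : y ∉ L := fun hm => ht x hxA hxL 0 ⟨y, hm, hy⟩
  obtain ⟨c2, L2, hE2, hs, hlt, hk2, hj2⟩ := hE1.exists_ear hA hyA (b := 0) (k := k)
    (by simp [hyx, hyL]) ⟨x, by simp, hy.symm⟩ (by simp [instrWeight]; omega)
  -- Otherwise the new keys `C` share no vertex with the rest of `A`, and `C.card ≤ spanCard h C` by
  -- the balance equations, so `A \ C` contradicts minimality.
  have hz : ∃ z ∈ A, z ∉ L2 ∧ ∃ b, Touches h L2 b z := by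
    by_contra! hno
    have hLL2 : ∀ y ∈ L, y ∈ L2 := fun y hy => hs.subset (List.mem_cons_of_mem _ hy)
    let C := L2.toFinset \ L.toFinset
    have hCA : C ⊆ A := by
      intro y hy
      simp only [C, Finset.mem_sdiff, List.mem_toFinset] at hy
      exact hE2.mem y hy.1
    have hxC : x ∈ C := by
      simp only [C, Finset.mem_sdiff, List.mem_toFinset]
      exact ⟨hs.subset (by simp), hxL⟩
    have hdisj : spanCard h (A \ C) + spanCard h C ≤ spanCard h A := by
      unfold spanCard
      rw [← Finset.sum_add_distrib]
      refine Finset.sum_le_sum fun b _ => ?_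
      rw [← Finset.card_union_of_disjoint]
      · exact Finset.card_le_card (Finset.union_subset
          (Finset.image_subset_image Finset.sdiff_subset) (Finset.image_subset_image hCA))
      · rw [Finset.disjoint_left]
        intro v hv hv'
        obtain ⟨y, hy, rfl⟩ := Finset.mem_image.1 hv
        obtain ⟨z, hz, hzy⟩ := Finset.mem_image.1 hv'
        simp only [C, Finset.mem_sdiff, List.mem_toFinset, not_and, not_not] at hy hz
        by_cases hyL2 : y ∈ L2
        · exact ht z (hE2.mem z hz.1) hz.2 b ⟨y, hy.2 hyL2, hzy.symm⟩
        · exact hno y hy.1 hyL2 b ⟨z, hz.1, hzy⟩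
    have hspan : spanCard h L2.toFinset ≤ spanCard h L.toFinset + spanCard h C := by
      unfold spanCard
      rw [← Finset.sum_add_distrib]
      refine Finset.sum_le_sum fun b _ => ?_
      refine le_trans (Finset.card_le_card ?_) (Finset.card_union_le _ _)
      rw [← Finset.image_union]
      apply Finset.image_subset_image
      intro y hy
      simp only [C, Finset.mem_union, Finset.mem_sdiff]
      tauto
    have hCcard : C.card + L.length = L2.length := by
      rw [← List.toFinset_card_of_nodup hE.nodup, ← List.toFinset_card_of_nodup hE2.nodup]
      exact Finset.card_sdiff_add_card_eq_card fun y hy => by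
        simpa using hLL2 y (by simpa using hy)
    have h1 := hmin (A \ C) (Finset.sdiff_ssubset hCA ⟨x, hxC⟩)
    have h2 := Finset.card_sdiff_add_card_eq_card hCA
    have h3 := hE.balance
    have h4 := hE2.balance
    omega
  obtain ⟨z, hzA, hzL, b, hz⟩ := hz
  obtain ⟨c3, L3, hE3, -, -, hk3, hj3⟩ := hE2.exists_ear hA hzA hzL hz (k := k + 1) (by omega)
  refine ⟨c3, L3, hE3, hk3, ?_⟩
  simp at hj2
  omega

/-- A set of keys that spans few vertices contains an exploration with many coincidences and
boundedly many jumps. -/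
lemma exists_exploration {s : ℕ} {A₀ : Finset U} (hcard₀ : spanCard h A₀ + s + 1 ≤ A₀.card) :
    ∃ c L, Exploration h A₀ c L ∧ L.length + (s + 1) = weight c ∧ jumps c ≤ 5 * (s + 1) := by
  classical
  obtain ⟨A, hAA, hA⟩ := exists_minimal_le_of_wellFoundedLT
    (fun A : Finset U => spanCard h A + s + 1 ≤ A.card) A₀ hcard₀
  have hmin : ∀ B ⊂ A, B.card < spanCard h B + s + 1 := fun B hB => by
    by_contra! hle
    exact hB.2 (hA.2 hle hB.1)
  have key : ∀ k ≤ s + 1, ∃ c L, Exploration h A c L ∧ L.length + k = weight c ∧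
      jumps c ≤ 5 * k := by
    intro k
    induction k with
    | zero => exact fun _ => ⟨[], [], .nil, by simp, by simp⟩
    | succ k ih =>
      intro hk
      obtain ⟨c, L, hE, hl, hj⟩ := ih (by omega)
      obtain ⟨c', L', hE', hl', hj'⟩ := hE.exists_progress hA.1 hmin hl (by omega)
      exact ⟨c', L', hE', hl', by omega⟩
  obtain ⟨c, L, hE, hl, hj⟩ := key (s + 1) le_rfl
  exact ⟨c, L, ⟨hE.sat, hE.nodup, fun x hx => hAA (hE.mem x hx), hE.balance, hE.tails⟩, hl, hj⟩

end Exploration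

/-! ### Counting the patterns of coincidences -/

section Codes

/-- The lists of `t` instructions with at most `K` jumps which refer only to numbers below `B`. -/
def codes (B : ℕ) : ℕ → ℕ → Finset (List Instr)
  | 0, _ => {[]}
  | t + 1, 0 => (codes B t 0).image (none :: ·)
  | t + 1, K + 1 => (codes B t (K + 1)).image (none :: ·) ∪
      Finset.image₂ (fun y c => some y :: c)
        (Finset.univ ×ˢ (Finset.range B).insertNone ×ˢ (Finset.range B).insertNone) (codes B t K)

/-- `none` offers no choice, so only the positions and contents of the at most `K` jumps count. The
bound satisfies the recursion since `(1 + t * y) + y = 1 + (t + 1) * y`. -/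
lemma card_codes_le (B : ℕ) : ∀ t K, (codes B t K).card ≤ (1 + t * (2 * (B + 1) ^ 2)) ^ K
  | 0, K => by simp [codes]
  | t + 1, 0 => by
    have := card_codes_le B t 0
    simp only [codes, pow_zero] at *
    exact Finset.card_image_le.trans this
  | t + 1, K + 1 => by
    have h1 := card_codes_le B t (K + 1)
    have h2 := card_codes_le B t K
    rw [codes]
    refine (Finset.card_union_le _ _).trans ?_
    have h3 := Finset.card_image₂_le (fun y c => (some y :: c : List Instr))
      (Finset.univ ×ˢ (Finset.range B).insertNone ×ˢ (Finset.range B).insertNone :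
        Finset (Fin 2 × Option ℕ × Option ℕ)) (codes B t K)
    have h4 : (Finset.univ ×ˢ (Finset.range B).insertNone ×ˢ (Finset.range B).insertNone :
        Finset (Fin 2 × Option ℕ × Option ℕ)).card = 2 * (B + 1) ^ 2 := by
      simp [Finset.card_product]
      ring
    rw [h4] at h3
    generalize 2 * (B + 1) ^ 2 = y at *
    calc _ ≤ (1 + t * y) ^ (K + 1) + y * (1 + t * y) ^ K := by
          refine add_le_add (Finset.card_image_le.trans h1) (h3.trans ?_)
          gcongr
      _ = (1 + t * y) ^ K * (1 + (t + 1) * y) := by ring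
      _ ≤ (1 + (t + 1) * y) ^ K * (1 + (t + 1) * y) := by gcongr; omega
      _ = (1 + (t + 1) * y) ^ (K + 1) := by ring

variable {U : Type*} {m : ℕ}

lemma Attached.lt {h : Fin 2 → U → Fin m} {L : List U} {x : U} {b : Fin 2} {o : Option ℕ}
    (ha : Attached h L x b o) {B : ℕ} (hB : L.length ≤ B) :
    o ∈ (Finset.range B).insertNone := by
  rw [Finset.mem_insertNone]
  intro j hj
  obtain ⟨y, hy, -⟩ := ha j hj
  obtain ⟨hj', -⟩ := List.getElem?_eq_some_iff.1 hy
  exact Finset.mem_range.2 (hj'.trans_le hB)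

lemma Sat.mem_codes {h : Fin 2 → U → Fin m} {B : ℕ} : ∀ {c : List Instr} {L : List U} {K : ℕ},
    Sat h c L → L.length ≤ B → jumps c ≤ K → c ∈ codes B L.length K
  | [], [], _, _, _, _ => by simp [codes]
  | none :: c, x :: L, K, hs, hB, hK => by
    have ih := Sat.mem_codes hs.1 (B := B) (K := K) (by simp at hB; omega) (by simpa using hK)
    cases K with
    | zero => simpa [codes] using ih
    | succ K =>
      simp only [List.length_cons, codes, Finset.mem_union]
      exact Or.inl (Finset.mem_image_of_mem _ ih)
  | some y :: c, x :: L, K, hs, hB, hK => by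
    cases K with
    | zero => simp at hK
    | succ K =>
      have ih := Sat.mem_codes hs.1 (B := B) (K := K) (by simp at hB; omega)
        (by simpa using hK)
      simp only [List.length_cons, codes, Finset.mem_union]
      right
      refine Finset.mem_image₂_of_mem ?_ ih
      have hB' : L.length ≤ B := by simp at hB; omega
      exact Finset.mem_product.2 ⟨Finset.mem_univ _,
        Finset.mem_product.2 ⟨hs.2.1.lt hB', hs.2.2.lt hB'⟩⟩
  | [], _ :: _, _, hs, _, _ => hs.elim
  | _ :: _, [], _, hs, _, _ => hs.elim

end Codes

/-! ### Counting by resampling coordinates -/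

section Counting

open Finset

lemma card_filter_add_right {Ψ : Type*} [Fintype Ψ] [AddGroup Ψ] (Q : Ψ → Prop)
    [DecidablePred Q] (w : Ψ) : #{ψ | Q (ψ + w)} = #{ψ | Q ψ} :=
  Finset.card_equiv (Equiv.addRight w) (by simp)

/-- Each translation permutes `Ψ`, so adding a random `e r` leaves the frequency of `Q` unchanged.
This allows one part of `ψ` to be resampled while the rest is fixed. -/
lemma card_filter_mul_card {Ψ κ : Type*} [Fintype Ψ] [AddGroup Ψ] [Fintype κ] (Q : Ψ → Prop)
    [DecidablePred Q] (e : κ → Ψ) :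
    #{ψ | Q ψ} * Fintype.card κ = ∑ ψ, #{r | Q (ψ + e r)} := by
  calc #{ψ | Q ψ} * Fintype.card κ = ∑ r : κ, #{ψ | Q ψ} := by
        rw [sum_const, card_univ, smul_eq_mul, mul_comm]
    _ = ∑ r : κ, #{ψ | Q (ψ + e r)} :=
        sum_congr rfl fun r _ => (card_filter_add_right Q (e r)).symm
    _ = _ := sum_card_bipartiteAbove_eq_sum_card_bipartiteBelow fun r ψ => Q (ψ + e r)

/-- If one coordinate of `ψ` is free with respect to the condition `P` and the value `a`, then
it equals `a` for a fraction `1 / |G|` of all `ψ`. -/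
lemma card_filter_and_eq_mul {Ψ G : Type*} [Fintype Ψ] [AddGroup Ψ] [Fintype G] [AddGroup G]
    [DecidableEq G] (e : G → Ψ) (ev a : Ψ → G) (P : Ψ → Prop) [DecidablePred P]
    (hev : ∀ ψ v, ev (ψ + e v) = ev ψ + v) (ha : ∀ ψ v, a (ψ + e v) = a ψ)
    (hP : ∀ ψ v, P (ψ + e v) ↔ P ψ) :
    #{ψ | P ψ ∧ ev ψ = a ψ} * Fintype.card G = #{ψ | P ψ} := by
  calc #{ψ | P ψ ∧ ev ψ = a ψ} * Fintype.card G
      = ∑ ψ, #{v | P ψ ∧ ev ψ + v = a ψ} := by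
        rw [card_filter_mul_card _ e]
        simp only [hev, ha, hP]
    _ = ∑ ψ with P ψ, 1 := by
        rw [sum_filter]
        refine sum_congr rfl fun ψ _ => ?_
        split_ifs with h
        · rw [card_eq_one]
          exact ⟨-ev ψ + a ψ, by ext v; simp [h, eq_neg_add_iff_add_eq]⟩
        · simp [h]
    _ = _ := by simp

/-- The number of functions with prescribed values at the images of `T` under an injection. -/
lemma card_filter_comp_eq_mul {ι κ G : Type*} [Fintype ι] [DecidableEq ι] [Fintype G]
    [DecidableEq G] (T : Finset κ) (g : κ → ι) (hg : Set.InjOn g T) (w : κ → G) :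
    #{r : ι → G | ∀ x ∈ T, r (g x) = w x} * Fintype.card G ^ #T =
      Fintype.card G ^ Fintype.card ι := by
  classical
  let t : ι → Finset G := fun a => univ.filter fun v => ∀ x ∈ T, g x = a → v = w x
  have h1 : ({r : ι → G | ∀ x ∈ T, r (g x) = w x} : Finset (ι → G)) = Fintype.piFinset t := by
    ext r
    simp only [mem_filter, mem_univ, true_and, Fintype.mem_piFinset, t]
    exact ⟨fun h a x hx hxa => hxa ▸ h x hx, fun h x hx => h _ x hx rfl⟩
  have h2 : ∀ a, #(t a) * (if a ∈ T.image g then Fintype.card G else 1) = Fintype.card G := by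
    intro a
    split_ifs with ha
    · obtain ⟨x, hx, rfl⟩ := mem_image.1 ha
      have : t (g x) = {w x} := by
        ext v
        simp only [t, mem_filter, mem_univ, true_and, mem_singleton]
        refine ⟨fun h => h x hx rfl, fun h y hy hyx => ?_⟩
        rw [h, hg hy hx hyx]
      rw [this, card_singleton, one_mul]
    · have : t a = univ := by
        ext v
        simp only [t, mem_filter, mem_univ, true_and, iff_true]
        intro x hx hxa
        exact absurd (mem_image.2 ⟨x, hx, hxa⟩) ha
      rw [this, card_univ, mul_one]
  have h3 : (∏ a, if a ∈ T.image g then Fintype.card G else 1) = Fintype.card G ^ #T := by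
    rw [prod_ite_mem, univ_inter, prod_const, card_image_of_injOn hg]
  rw [h1, Fintype.card_piFinset, ← h3, ← prod_mul_distrib, prod_congr rfl fun a _ => h2 a]
  simp

end Counting

/-! ### Comparison with fully random hash functions -/

section Random

open Finset

variable {U : Type*} {m : ℕ}

lemma Attached.congr {h h' : Fin 2 → U → Fin m} {L : List U} {x : U} {b : Fin 2} {o : Option ℕ}
    (hL : ∀ y ∈ L, h b y = h' b y) (hx : h b x = h' b x) (ha : Attached h L x b o) :
    Attached h' L x b o := by
  intro j hj
  obtain ⟨y, hy, hxy⟩ := ha j hj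
  exact ⟨y, hy, by rw [← hx, hxy, hL y (List.mem_of_getElem? hy)]⟩

lemma Sat.congr {h h' : Fin 2 → U → Fin m} : ∀ {c : List Instr} {L : List U},
    (∀ y ∈ L, ∀ b, h b y = h' b y) → Sat h c L → Sat h' c L
  | [], [], _, _ => trivial
  | _ :: _, x :: _, hL, hs =>
    ⟨Sat.congr (fun y hy => hL y (List.mem_cons_of_mem _ hy)) hs.1,
      hs.2.1.congr (fun y hy => hL y (List.mem_cons_of_mem _ hy) _) (hL x (by simp) _),
      hs.2.2.congr (fun y hy => hL y (List.mem_cons_of_mem _ hy) _) (hL x (by simp) _)⟩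
  | [], _ :: _, _, hs => hs.elim
  | _ :: _, [], _, hs => hs.elim

open Classical in
/-- A set of keys is good for `g` if `g` has at most one collision on it. -/
def GoodFor {ℓ : ℕ} (T : Finset U) (g : U → Fin ℓ) : Prop := #T ≤ #(T.image g) + 1

open Classical in
lemma GoodFor.injOn_or {ℓ : ℕ} {T : Finset U} {g : U → Fin ℓ} (hT : GoodFor T g) :
    Set.InjOn g T ∨ ∃ x ∈ T, ∃ y ∈ T, x ≠ y ∧ g x = g y ∧ Set.InjOn g (T.erase y) := by
  by_cases hinj : Set.InjOn g T
  · exact Or.inl hinj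
  right
  simp only [Set.InjOn, mem_coe, not_forall] at hinj
  obtain ⟨x, hx, y, hy, hxy, hne⟩ := hinj
  refine ⟨x, hx, y, hy, hne, hxy, ?_⟩
  have h1 : T.image g = (T.erase y).image g := by
    refine Subset.antisymm (fun a ha => ?_) (image_subset_image (erase_subset _ _))
    obtain ⟨z, hz, rfl⟩ := mem_image.1 ha
    by_cases hzy : z = y
    · exact mem_image.2 ⟨x, mem_erase.2 ⟨hne, hx⟩, by rw [hxy, hzy]⟩
    · exact mem_image_of_mem _ (mem_erase.2 ⟨hzy, hz⟩)
  rw [← card_image_iff]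
  refine le_antisymm card_image_le ?_
  rw [← h1, card_erase_of_mem hy]
  unfold GoodFor at hT
  omega

variable [Fintype U] [NeZero m]

-- The value `ψ b x` is free with respect to `P` and to the value it has to match, so a prescribed
-- coincidence costs a factor `m`. A number out of range can never be attained.
open Classical in
lemma card_attached_mul_le {L : List U} {x : U} (hx : x ∉ L) (b : Fin 2) (o : Option ℕ)
    (P : (Fin 2 → U → Fin m) → Prop)
    (hP : ∀ ψ v, P (ψ + Pi.single b (Pi.single x v)) ↔ P ψ) :
    #{ψ | P ψ ∧ Attached ψ L x b o} * m ^ (if o.isSome then 1 else 0) ≤ #{ψ | P ψ} := by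
  cases o with
  | none =>
    simp only [Option.isSome_none, Bool.false_eq_true, if_false, pow_zero, mul_one]
    exact card_le_card fun ψ => by simp; tauto
  | some j =>
    simp only [Option.isSome_some, if_true, pow_one]
    by_cases hj : j < L.length
    · have hy : L[j] ≠ x := fun h => hx (h ▸ List.getElem_mem hj)
      have h1 := card_filter_and_eq_mul (fun v => Pi.single b (Pi.single x v))
        (fun ψ : Fin 2 → U → Fin m => ψ b x) (fun ψ => ψ b L[j]) P (by simp)
        (by simp [hy]) hP
      rw [Fintype.card_fin] at h1
      rw [← h1]
      refine Nat.mul_le_mul_right _ (card_le_card fun ψ => ?_)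
      simp only [mem_filter, mem_univ, true_and]
      rintro ⟨h2, h3⟩
      obtain ⟨y, hy, hxy⟩ := h3 j rfl
      rw [List.getElem?_eq_getElem hj, Option.some_inj] at hy
      exact ⟨h2, by rw [hxy, hy]⟩
    · have : ∀ ψ : Fin 2 → U → Fin m, ¬ Attached ψ L x b (some j) := by
        intro ψ ha
        obtain ⟨y, hy, -⟩ := ha j rfl
        exact hj (List.getElem?_eq_some_iff.1 hy).1
      simp [this]

open Classical in
/-- Prescribed coincidences are independent under fully random hash functions. -/
lemma card_sat_mul_le : ∀ (c : List Instr) (L : List U), L.Nodup →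
    #{ψ : Fin 2 → U → Fin m | Sat ψ c L} * m ^ weight c ≤ (m ^ Fintype.card U) ^ 2
  | [], [], _ => by
    refine (Nat.mul_le_mul_right _ (card_le_univ _)).trans ?_
    simp
  | i :: c, x :: L, hL => by
    obtain ⟨hx, hL⟩ := List.nodup_cons.1 hL
    have ih := card_sat_mul_le c L hL
    set b := (resolve c i).1
    have hne : ∀ y ∈ L, y ≠ x := fun y hy h => hx (h ▸ hy)
    have hsat : ∀ (b : Fin 2) (ψ : Fin 2 → U → Fin m) v,
        Sat (ψ + Pi.single b (Pi.single x v)) c L ↔ Sat ψ c L := by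
      intro b ψ v
      have : ∀ y ∈ L, ∀ b', (ψ + Pi.single b (Pi.single x v) : Fin 2 → U → Fin m) b' y =
          ψ b' y := by
        intro y hy b'
        rcases side_eq_or b b' with rfl | rfl <;> simp [hne y hy]
      exact ⟨Sat.congr this, Sat.congr fun y hy b' => (this y hy b').symm⟩
    have hatt : ∀ (ψ : Fin 2 → U → Fin m) v,
        Attached (ψ + Pi.single (b + 1) (Pi.single x v)) L x b (resolve c i).2.1 ↔
          Attached ψ L x b (resolve c i).2.1 := by
      intro ψ v
      have : ∀ y, (ψ + Pi.single (b + 1) (Pi.single x v) : Fin 2 → U → Fin m) b y = ψ b y := by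
        intro y
        simp
      exact ⟨Attached.congr (fun y _ => this y) (this x),
        Attached.congr (fun y _ => (this y).symm) (this x).symm⟩
    have h1 := card_attached_mul_le hx b (resolve c i).2.1 (fun ψ => Sat ψ c L) (hsat b)
    -- The two ends of `x` are peeled off one by one: the condition on side `b` does not involve `ψ
    -- (b + 1) x`.
    have h2 := card_attached_mul_le hx (b + 1) (resolve c i).2.2
      (fun ψ => Sat ψ c L ∧ Attached ψ L x b (resolve c i).2.1)
      (fun ψ v => by rw [hsat, hatt])
    rw [weight_cons, instrWeight_eq c i]
    simp only [Sat, ← and_assoc]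
    refine le_trans ?_ ih
    rw [pow_add, ← mul_assoc]
    refine Nat.mul_le_mul_right _ (le_trans ?_ h1)
    rw [pow_add, mul_comm (m ^ _) (m ^ _), ← mul_assoc]
    exact Nat.mul_le_mul_right _ (by convert h2)
  | [], x :: L, _ => by
    rw [filter_false_of_mem (p := fun ψ => Sat ψ [] (x :: L)) fun _ _ hs => hs]
    simp
  | i :: c, [], _ => by
    rw [filter_false_of_mem (p := fun ψ => Sat ψ (i :: c) []) fun _ _ hs => hs]
    simp

variable {c ℓ : ℕ}

open Classical in
/-- If `g j` has at most one collision on `T`, the values of a hash function on `T` are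
uniformly distributed. -/
lemma card_hash_eq_mul_le (H : Finset (U → Fin m))
    (hH : ∀ x y, x ≠ y → ∀ i j, #{f ∈ H | f x = i ∧ f y = j} * m ^ 2 ≤ #H)
    (g : Fin c → U → Fin ℓ) (j : Fin c) (T : Finset U) (hT : GoodFor T (g j)) (ψ : U → Fin m) :
    #{k : (U → Fin m) × (Fin c → Fin ℓ → Fin m) |
        k.1 ∈ H ∧ ∀ x ∈ T, k.1 x + ∑ j, k.2 j (g j x) = ψ x} * m ^ #T ≤
      #H * Fintype.card (Fin c → Fin ℓ → Fin m) := by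
  set Q : (U → Fin m) → (Fin c → Fin ℓ → Fin m) → Prop :=
    fun f z => ∀ x ∈ T, f x + ∑ j, z j (g j x) = ψ x with hQ
  have hsum : ∀ (z : Fin c → Fin ℓ → Fin m) (r : Fin ℓ → Fin m) x,
      ∑ j', (z + Pi.single j r : Fin c → Fin ℓ → Fin m) j' (g j' x) = ∑ j', z j' (g j' x) + r (g j x) := by
    intro z r x
    simp only [Pi.add_apply, sum_add_distrib]
    congr 1
    rw [Finset.sum_eq_single j (fun j' _ hj' => by simp [hj']) (by simp)]
    simp
  have hQr : ∀ f (z : Fin c → Fin ℓ → Fin m) (r : Fin ℓ → Fin m), Q f (z + Pi.single j r) ↔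
      ∀ x ∈ T, r (g j x) = ψ x - (f x + ∑ j', z j' (g j' x)) := by
    intro f z r
    refine forall₂_congr fun x _ => ?_
    rw [hsum, ← add_assoc, eq_sub_iff_add_eq']
  -- Row `j` of the table is resampled by adding `r`, with `f` and the table `z` fixed.
  have hN : #{k : (U → Fin m) × (Fin c → Fin ℓ → Fin m) | k.1 ∈ H ∧ Q k.1 k.2} * m ^ ℓ =
      ∑ z : Fin c → Fin ℓ → Fin m, ∑ f ∈ H, #{r : Fin ℓ → Fin m | Q f (z + Pi.single j r)} := by
    have h1 : #{k : (U → Fin m) × (Fin c → Fin ℓ → Fin m) | k.1 ∈ H ∧ Q k.1 k.2} =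
        ∑ f ∈ H, #{z | Q f z} := by
      rw [← Finset.card_sigma]
      refine Finset.card_bij (fun k _ => ⟨k.1, k.2⟩) ?_ ?_ ?_
      · rintro ⟨f, z⟩
        simp
      · rintro ⟨f, z⟩ _ ⟨f', z'⟩ _
        simp
      · rintro ⟨f, z⟩
        simp
    have h2 : ∀ f, #{z | Q f z} * m ^ ℓ =
        ∑ z : Fin c → Fin ℓ → Fin m, #{r : Fin ℓ → Fin m | Q f (z + Pi.single j r)} := by
      intro f
      have := card_filter_mul_card (Q f) (fun r : Fin ℓ → Fin m => Pi.single j r)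
      simpa using this
    rw [h1, sum_mul, sum_comm]
    exact sum_congr rfl fun f _ => h2 f
  have hm : 0 < m := NeZero.pos m
  have hpos : 0 < m ^ ℓ := pow_pos hm _
  have hcard : ∀ f (z : Fin c → Fin ℓ → Fin m) (T₀ : Finset U), T₀ ⊆ T → Set.InjOn (g j) T₀ →
      #{r : Fin ℓ → Fin m | Q f (z + Pi.single j r)} * m ^ #T₀ ≤ m ^ ℓ := by
    intro f z T₀ hT₀ hinj
    have h1 := card_filter_comp_eq_mul T₀ (g j) hinj
      (fun x => ψ x - (f x + ∑ j', z j' (g j' x)))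
    rw [Fintype.card_fin, Fintype.card_fin] at h1
    rw [← h1]
    refine Nat.mul_le_mul_right _ (card_le_card fun r => ?_)
    simp only [mem_filter, mem_univ, true_and, hQr]
    exact fun h x hx => h x (hT₀ hx)
  refine Nat.le_of_mul_le_mul_right ?_ hpos
  rw [mul_right_comm, hN, sum_mul]
  have hz : ∀ z : Fin c → Fin ℓ → Fin m,
      (∑ f ∈ H, #{r : Fin ℓ → Fin m | Q f (z + Pi.single j r)}) * m ^ #T ≤ #H * m ^ ℓ := by
    intro z
    rcases hT.injOn_or with hinj | ⟨x, hx, y, hy, hxy, hg, hinj⟩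
    · rw [sum_mul, ← smul_eq_mul, ← sum_const]
      exact sum_le_sum fun f _ => hcard f z T Subset.rfl hinj
    · let a : Fin m := (ψ x - ∑ j', z j' (g j' x)) - (ψ y - ∑ j', z j' (g j' y))
      have h1 : ∀ f ∈ H, #{r : Fin ℓ → Fin m | Q f (z + Pi.single j r)} * m ^ #T ≤
          if f x = f y + a then m ^ ℓ * m else 0 := by
        intro f _
        split_ifs with hf
        · have h2 := hcard f z (T.erase y) (erase_subset _ _) hinj
          have h3 : #T = #(T.erase y) + 1 := (card_erase_add_one hy).symm
          rw [h3, pow_succ, ← mul_assoc]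
          exact Nat.mul_le_mul_right _ h2
        · rw [Nat.le_zero, mul_eq_zero]
          left
          rw [card_eq_zero, filter_eq_empty_iff]
          intro r _ hr
          rw [hQr] at hr
          apply hf
          have e1 := hr x hx
          rw [hg, hr y hy] at e1
          have e2 : f x = ψ x - ∑ j', z j' (g j' x) -
              (ψ x - (f x + ∑ j', z j' (g j' x))) := by abel
          rw [e2, ← e1]
          simp only [a]
          abel
      have h2 : #{f ∈ H | f x = f y + a} * m ≤ #H := by
        have h3 : #{f ∈ H | f x = f y + a} ≤ ∑ v : Fin m, #{f ∈ H | f x = v + a ∧ f y = v} := by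
          refine le_trans (card_le_card fun f hf => ?_) card_biUnion_le
          simp only [mem_filter, mem_biUnion, mem_univ, true_and] at hf ⊢
          exact ⟨f y, hf.1, hf.2, rfl⟩
        have h4 : (∑ v : Fin m, #{f ∈ H | f x = v + a ∧ f y = v}) * m ^ 2 ≤ m * #H := by
          rw [sum_mul]
          refine (sum_le_sum fun v _ => hH x y hxy (v + a) v).trans ?_
          simp
        refine Nat.le_of_mul_le_mul_left ?_ hm
        calc m * (#{f ∈ H | f x = f y + a} * m) = #{f ∈ H | f x = f y + a} * m ^ 2 := by ring
          _ ≤ _ := Nat.mul_le_mul_right _ h3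
          _ ≤ _ := h4
      rw [sum_mul]
      refine (sum_le_sum h1).trans ?_
      rw [← sum_filter, sum_const, smul_eq_mul]
      calc #{f ∈ H | f x = f y + a} * (m ^ ℓ * m) = (#{f ∈ H | f x = f y + a} * m) * m ^ ℓ := by
            ring
        _ ≤ _ := Nat.mul_le_mul_right _ h2
  refine (sum_le_sum fun z _ => hz z).trans ?_
  simp only [sum_const, smul_eq_mul, card_univ]
  exact le_of_eq (by ring)

open Classical in
/-- If some `g j` has at most one collision on `L`, prescribed coincidences on `L` are as
probable as under fully random hash functions. -/
lemma card_sat_hash_mul_le (H : Finset (U → Fin m))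
    (hH : ∀ x y, x ≠ y → ∀ i j, #{f ∈ H | f x = i ∧ f y = j} * m ^ 2 ≤ #H)
    (g : Fin c → U → Fin ℓ) (L : List U) (hL : L.Nodup)
    (hT : ∃ j, GoodFor L.toFinset (g j)) (is : List Instr) :
    #{k : Fin 2 → (U → Fin m) × (Fin c → Fin ℓ → Fin m) | (∀ i, (k i).1 ∈ H) ∧
        Sat (fun i x => (k i).1 x + ∑ j, (k i).2 j (g j x)) is L} * m ^ weight is ≤
      (#H * Fintype.card (Fin c → Fin ℓ → Fin m)) ^ 2 := by
  obtain ⟨j, hT⟩ := hT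
  set T := L.toFinset with hTdef
  set X := (U → Fin m) × (Fin c → Fin ℓ → Fin m)
  let hash : X → U → Fin m := fun k x => k.1 x + ∑ j, k.2 j (g j x)
  set D := #H * Fintype.card (Fin c → Fin ℓ → Fin m)
  let agree : (Fin 2 → U → Fin m) → (Fin 2 → U → Fin m) → Prop :=
    fun ψ ψ' => ∀ i, ∀ x ∈ T, ψ i x = ψ' i x
  have hm : 0 < m := NeZero.pos m
  set N := #{k : Fin 2 → X | (∀ i, (k i).1 ∈ H) ∧ Sat (fun i => hash (k i)) is L} with hN
  change N * _ ≤ _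
  have hagree : ∀ ψ' : Fin 2 → U → Fin m,
      #{ψ | agree ψ ψ'} * (m ^ #T) ^ 2 = (m ^ Fintype.card U) ^ 2 := by
    intro ψ'
    have h1 : ({ψ | agree ψ ψ'} : Finset (Fin 2 → U → Fin m)) =
        Fintype.piFinset fun i => {r | ∀ x ∈ T, r x = ψ' i x} := by
      ext ψ
      simp [agree]
    have h2 : ∀ i, #{r : U → Fin m | ∀ x ∈ T, r x = ψ' i x} * m ^ #T = m ^ Fintype.card U := by
      intro i
      have := card_filter_comp_eq_mul T id Function.injective_id.injOn (ψ' i)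
      simpa using this
    rw [h1, Fintype.card_piFinset, Fin.prod_univ_two, sq, mul_mul_mul_comm, h2, h2, sq]
  have hpair : ∀ ψ : Fin 2 → U → Fin m,
      #{k : Fin 2 → X | (∀ i, (k i).1 ∈ H) ∧ agree (fun i => hash (k i)) ψ} * (m ^ #T) ^ 2 ≤
        D ^ 2 := by
    intro ψ
    have h1 : ({k : Fin 2 → X | (∀ i, (k i).1 ∈ H) ∧ agree (fun i => hash (k i)) ψ} :
        Finset (Fin 2 → X)) =
        Fintype.piFinset fun i => {k : X | k.1 ∈ H ∧ ∀ x ∈ T, hash k x = ψ i x} := by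
      ext k
      simp [agree, forall_and]
    have h2 : ∀ i, #{k : X | k.1 ∈ H ∧ ∀ x ∈ T, hash k x = ψ i x} * m ^ #T ≤ D := fun i =>
      card_hash_eq_mul_le H hH g j T hT (ψ i)
    rw [h1, Fintype.card_piFinset, Fin.prod_univ_two, sq, mul_mul_mul_comm, sq]
    exact Nat.mul_le_mul (h2 0) (h2 1)
  -- Pairs of a hash pair `k` and a fully random `ψ` that agree on `T` are counted in two ways;
  -- `Sat` depends only on the values on `T`.
  have hdouble : N * (m ^ Fintype.card U) ^ 2 = ∑ ψ : Fin 2 → U → Fin m with Sat ψ is L,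
      #{k : Fin 2 → X | (∀ i, (k i).1 ∈ H) ∧ agree (fun i => hash (k i)) ψ} * (m ^ #T) ^ 2 := by
    rw [← sum_mul]
    have h1 : ∑ ψ : Fin 2 → U → Fin m with Sat ψ is L,
        #{k : Fin 2 → X | (∀ i, (k i).1 ∈ H) ∧ agree (fun i => hash (k i)) ψ} =
        ∑ k : Fin 2 → X with (∀ i, (k i).1 ∈ H) ∧ Sat (fun i => hash (k i)) is L,
          #{ψ | agree ψ (fun i => hash (k i))} := by
      simp only [card_filter]
      rw [sum_filter, sum_filter]
      have e1 : ∀ ψ : Fin 2 → U → Fin m, (if Sat ψ is L then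
          ∑ k : Fin 2 → X, if (∀ i, (k i).1 ∈ H) ∧ agree (fun i => hash (k i)) ψ then 1 else 0
          else 0) = ∑ k : Fin 2 → X, if (∀ i, (k i).1 ∈ H) ∧ agree (fun i => hash (k i)) ψ ∧
            Sat ψ is L then 1 else 0 := by
        intro ψ
        split_ifs with hs <;> simp [hs]
      have e2 : ∀ k : Fin 2 → X, (if (∀ i, (k i).1 ∈ H) ∧ Sat (fun i => hash (k i)) is L then
          ∑ ψ : Fin 2 → U → Fin m, if agree ψ (fun i => hash (k i)) then 1 else 0
          else 0) = ∑ ψ : Fin 2 → U → Fin m, if ((∀ i, (k i).1 ∈ H) ∧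
            Sat (fun i => hash (k i)) is L) ∧ agree ψ (fun i => hash (k i))
            then 1 else 0 := by
        intro k
        split_ifs with hs
        · exact sum_congr rfl fun ψ _ => if_congr (and_iff_right hs).symm rfl rfl
        · simp only [hs, false_and, if_false, sum_const_zero]
      rw [sum_congr rfl fun ψ _ => e1 ψ, sum_congr rfl fun k _ => e2 k, sum_comm]
      refine sum_congr rfl fun k _ => sum_congr rfl fun ψ _ => ?_
      congr 1
      rw [eq_iff_iff]
      constructor
      · rintro ⟨hk, ha, hs⟩
        exact ⟨⟨hk, hs.congr fun y hy b => (ha b y (by simpa [hTdef] using hy)).symm⟩,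
          fun i x hx => (ha i x hx).symm⟩
      · rintro ⟨⟨hk, hs⟩, ha⟩
        exact ⟨hk, fun i x hx => (ha i x hx).symm,
          hs.congr fun y hy b => (ha b y (by simpa [hTdef] using hy)).symm⟩
    rw [h1, sum_mul, sum_congr rfl fun k _ => hagree _]
    simp [hN]
  have hpos : 0 < (m ^ Fintype.card U) ^ 2 := pow_pos (pow_pos hm _) _
  refine Nat.le_of_mul_le_mul_right ?_ hpos
  calc N * m ^ weight is * (m ^ Fintype.card U) ^ 2
      = (N * (m ^ Fintype.card U) ^ 2) * m ^ weight is := by ring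
    _ ≤ (∑ ψ : Fin 2 → U → Fin m with Sat ψ is L, D ^ 2) * m ^ weight is := by
        rw [hdouble]
        exact Nat.mul_le_mul_right _ (sum_le_sum fun ψ _ => hpair ψ)
    _ = D ^ 2 * (#{ψ : Fin 2 → U → Fin m | Sat ψ is L} * m ^ weight is) := by
        rw [sum_const, smul_eq_mul]
        ring
    _ ≤ _ := Nat.mul_le_mul_left _ (card_sat_mul_le is L hL)

end Random

/-! ### Union bound and monotonicity -/

section UniformPr

open Finset

variable {α : Type*}

lemma uniformPr_or_le (A : Set α) (P Q : α → Prop) :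
    uniformPr A (fun a => P a ∨ Q a) ≤ uniformPr A P + uniformPr A Q := by
  unfold uniformPr
  rw [← add_div]
  gcongr
  rw [show {a | a ∈ A ∧ (P a ∨ Q a)} = {a | a ∈ A ∧ P a} ∪ {a | a ∈ A ∧ Q a} by
    ext; simp [and_or_left]]
  exact_mod_cast Set.ncard_union_le _ _

lemma uniformPr_exists_le {ι : Type*} (A : Set α) (I : Finset ι) (P : ι → α → Prop) :
    uniformPr A (fun a => ∃ i ∈ I, P i a) ≤ ∑ i ∈ I, uniformPr A (P i) := by
  classical
  induction I using Finset.induction_on with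
  | empty => simp [uniformPr]
  | insert i I hi ih =>
    rw [sum_insert hi]
    simp only [Finset.exists_mem_insert]
    exact (uniformPr_or_le A _ _).trans (by gcongr)

variable [Finite α]

lemma uniformPr_mono {A : Set α} {P Q : α → Prop} (h : ∀ a ∈ A, P a → Q a) :
    uniformPr A P ≤ uniformPr A Q := by
  unfold uniformPr
  gcongr
  · exact Set.toFinite _
  · exact fun ha => h _ ‹_› ha

end UniformPr

/-! ### The union bound for the hash class -/

section HashClass

open Finset

variable {U : Type*} {c d ℓ m : ℕ}

/-- A sequence of hash functions, with each `fᵢ` paired with its table. -/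
def hashEquiv (U : Type*) (c d ℓ m : ℕ) :
    HashSeq U c d ℓ m ≃
      (Fin c → U → Fin ℓ) × (Fin d → (U → Fin m) × (Fin c → Fin ℓ → Fin m)) where
  toFun h := (h.g, fun i => (h.f i, h.z i))
  invFun p := ⟨fun i => (p.2 i).1, p.1, fun i => (p.2 i).2⟩
  left_inv _ := rfl
  right_inv _ := rfl

instance [Finite U] : Finite (HashSeq U c d ℓ m) := Finite.of_equiv _ (hashEquiv U c d ℓ m).symm

lemma val_sum {ι : Type*} [NeZero m] (s : Finset ι) (a : ι → Fin m) :
    ((∑ i ∈ s, a i : Fin m) : ℕ) = (∑ i ∈ s, (a i : ℕ)) % m := by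
  classical
  induction s using Finset.induction_on with
  | empty => simp
  | insert i s hi ih =>
    rw [sum_insert hi, sum_insert hi, Fin.val_add, ih, Nat.add_mod_mod]

lemma HashSeq.hash_eq [NeZero m] (h : HashSeq U c d ℓ m) (i : Fin d) (x : U) :
    h.hash i x = h.f i x + ∑ j, h.z i j (h.g j x) := by
  ext
  rw [Fin.val_add, val_sum, Nat.add_mod_mod]
  rfl

open Classical in
/-- A list of keys is critical if all `g j` collide on it, but some `g j` only once. -/
def CriticalFor (T : Finset U) (g : Fin c → U → Fin ℓ) : Prop :=
  (∃ j, GoodFor T (g j)) ∧ ∀ j, ¬ Set.InjOn (g j) T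

open Classical in
/-- A list which is not good has a critical tail. -/
lemma Sat.exists_critical [NeZero c] {h : Fin 2 → U → Fin m} (g : Fin c → U → Fin ℓ) :
    ∀ {is : List Instr} {L : List U}, Sat h is L → L.Nodup →
      (¬ ∃ j, GoodFor L.toFinset (g j)) →
      ∃ is' L', is' <:+ is ∧ L' <:+ L ∧ Sat h is' L' ∧ CriticalFor L'.toFinset g
  | [], [], _, _, hbad => (hbad ⟨0, by simp [GoodFor]⟩).elim
  | i :: is, x :: L, hs, hL, hbad => by
    by_cases hgood : ∃ j, GoodFor L.toFinset (g j)
    -- The first good tail is critical: were `g j` injective on it, adding `x` back would create at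
    -- most one collision, and the longer list would still be good.
    · refine ⟨is, L, List.suffix_cons _ _, List.suffix_cons _ _, hs.1, hgood, ?_⟩
      intro j hinj
      refine hbad ⟨j, ?_⟩
      have h1 := card_image_iff.2 hinj
      have h2 : #(L.toFinset.image (g j)) ≤ #((x :: L).toFinset.image (g j)) :=
        card_le_card (image_subset_image (by intro y; simp; tauto))
      have h3 : #(x :: L).toFinset ≤ #L.toFinset + 1 := by
        rw [List.toFinset_cons]
        exact card_insert_le _ _
      unfold GoodFor
      omega
    · obtain ⟨is', L', h1, h2, h3, h4⟩ :=
        Sat.exists_critical g hs.1 (List.nodup_cons.1 hL).2 hgood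
      exact ⟨is', L', h1.trans (List.suffix_cons _ _), h2.trans (List.suffix_cons _ _), h3, h4⟩
  | [], _ :: _, hs, _, _ => hs.elim
  | _ :: _, [], hs, _, _ => hs.elim

open Classical in
/-- The lists of `t` entries from `S`. -/
def listsOf (S : Finset U) (t : ℕ) : Finset (List U) :=
  (Fintype.piFinset fun _ : Fin t => S).image List.ofFn

lemma mem_listsOf {S : Finset U} {L : List U} (hL : ∀ x ∈ L, x ∈ S) : L ∈ listsOf S L.length := by
  classical
  refine mem_image.2 ⟨L.get, ?_, List.ofFn_get L⟩
  rw [Fintype.mem_piFinset]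
  exact fun i => hL _ (List.get_mem L i)

lemma length_of_mem_listsOf {S : Finset U} {t : ℕ} {L : List U} (hL : L ∈ listsOf S t) :
    L.length = t := by
  classical
  obtain ⟨f, -, rfl⟩ := mem_image.1 hL
  simp

lemma card_listsOf_le (S : Finset U) (t : ℕ) : #(listsOf S t) ≤ #S ^ t := by
  classical
  exact card_image_le.trans (by simp)

variable [Fintype U]

open Classical in
lemma ncard_hashClassZ (F : Finset (U → Fin ℓ)) (H : Finset (U → Fin m))
    (P : HashSeq U c d ℓ m → Prop) :
    {h | h ∈ hashClassZ c d (F : Set (U → Fin ℓ)) (H : Set (U → Fin m)) ∧ P h}.ncard =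
      ∑ g ∈ Fintype.piFinset fun _ : Fin c => F,
        #{k | (∀ i, (k i).1 ∈ H) ∧ P ((hashEquiv U c d ℓ m).symm (g, k))} := by
  rw [← card_sigma, ← Set.ncard_coe_finset]
  refine Set.ncard_congr (fun h _ => ⟨h.g, fun i => (h.f i, h.z i)⟩) ?_ ?_ ?_
  · rintro h ⟨⟨h1, h2⟩, hP⟩
    simp only [coe_sigma, Set.mem_sigma_iff, mem_coe, Fintype.mem_piFinset, mem_filter, mem_univ,
      true_and]
    exact ⟨h2, h1, hP⟩
  · rintro h h' _ _ heq
    apply (hashEquiv U c d ℓ m).injective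
    simp only [Sigma.mk.injEq, heq_eq_eq] at heq
    exact Prod.ext heq.1 heq.2
  · rintro ⟨g, k⟩ hgk
    simp only [coe_sigma, Set.mem_sigma_iff, mem_coe, Fintype.mem_piFinset, mem_filter, mem_univ,
      true_and] at hgk
    exact ⟨(hashEquiv U c d ℓ m).symm (g, k), ⟨⟨hgk.2.1, hgk.1⟩, hgk.2.2⟩, rfl⟩

open Classical in
lemma ncard_hashClassZ_two (F : Finset (U → Fin ℓ)) (H : Finset (U → Fin m)) :
    (hashClassZ c 2 (F : Set (U → Fin ℓ)) (H : Set (U → Fin m))).ncard =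
      #(Fintype.piFinset fun _ : Fin c => F) *
        (#H * Fintype.card (Fin c → Fin ℓ → Fin m)) ^ 2 := by
  have h1 := ncard_hashClassZ (c := c) (d := 2) F H fun _ => True
  simp only [and_true, Set.ofPred_mem_eq] at h1
  rw [h1, ← smul_eq_mul, ← sum_const]
  refine sum_congr rfl fun g _ => ?_
  have h2 : ({k | ∀ i, (k i).1 ∈ H} :
      Finset (Fin 2 → (U → Fin m) × (Fin c → Fin ℓ → Fin m))) =
      Fintype.piFinset fun _ => H ×ˢ univ := by
    ext k
    simp
  rw [h2, Fintype.card_piFinset, prod_const, card_product, card_univ, card_univ]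
  simp

open Classical in
/-- Coincidences prescribed on a list of keys, intersected with an event for the functions
`g₁, …, g_c` under which the list is good. -/
lemma uniformPr_sat_le [NeZero m] (F : Finset (U → Fin ℓ)) (H : Finset (U → Fin m))
    (hHne : H.Nonempty)
    (hH : ∀ x y, x ≠ y → ∀ i j, #{f ∈ H | f x = i ∧ f y = j} * m ^ 2 ≤ #H)
    (L : List U) (hL : L.Nodup) (is : List Instr) (Q : (Fin c → U → Fin ℓ) → Prop)
    (hQ : ∀ g, Q g → ∃ j, GoodFor L.toFinset (g j)) :
    uniformPr (hashClassZ c 2 (F : Set (U → Fin ℓ)) (H : Set (U → Fin m)))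
        (fun h => Sat h.hash is L ∧ Q h.g) ≤
      (#{g ∈ Fintype.piFinset fun _ : Fin c => F | Q g} : ℝ) /
        #(Fintype.piFinset fun _ : Fin c => F) / (m : ℝ) ^ weight is := by
  have hm : 0 < m := NeZero.pos m
  set D := #H * Fintype.card (Fin c → Fin ℓ → Fin m) with hD
  have hDpos : 0 < D := Nat.mul_pos hHne.card_pos Fintype.card_pos
  have key : {h | h ∈ hashClassZ c 2 (F : Set (U → Fin ℓ)) (H : Set (U → Fin m)) ∧
      (Sat h.hash is L ∧ Q h.g)}.ncard * m ^ weight is ≤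
      #{g ∈ Fintype.piFinset fun _ : Fin c => F | Q g} * D ^ 2 := by
    rw [ncard_hashClassZ F H, sum_mul, ← smul_eq_mul, ← sum_const, sum_filter]
    refine sum_le_sum fun g _ => ?_
    split_ifs with hg
    · refine le_trans (Nat.mul_le_mul_right _ (card_le_card fun k => ?_))
        (card_sat_hash_mul_le H hH g L hL (hQ g hg) is)
      simp only [mem_filter, mem_univ, true_and]
      rintro ⟨h1, h2, -⟩
      refine ⟨h1, h2.congr fun y _ i => ?_⟩
      rw [HashSeq.hash_eq]
      rfl
    · rw [Nat.le_zero, mul_eq_zero]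
      left
      rw [card_eq_zero, eq_empty_iff_forall_notMem]
      intro k hk
      simp only [mem_filter, mem_univ, true_and] at hk
      exact hg hk.2.2
  unfold uniformPr
  rw [ncard_hashClassZ_two, ← hD, div_div]
  rcases Nat.eq_zero_or_pos #(Fintype.piFinset fun _ : Fin c => F) with h0 | h0
  · simp [h0]
  rw [div_le_div_iff₀ (by positivity) (by positivity)]
  have key' : ({h | h ∈ hashClassZ c 2 (F : Set (U → Fin ℓ)) (H : Set (U → Fin m)) ∧
      (Sat h.hash is L ∧ Q h.g)}.ncard : ℝ) * (m : ℝ) ^ weight is ≤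
      #{g ∈ Fintype.piFinset fun _ : Fin c => F | Q g} * (D : ℝ) ^ 2 := by
    exact_mod_cast key
  have h0' : (0 : ℝ) ≤ #(Fintype.piFinset fun _ : Fin c => F) := by positivity
  push_cast
  nlinarith [mul_le_mul_of_nonneg_left key' h0']

-- A union bound over pairs of keys controls the collisions of one `g j`; independence of the `c`
-- functions gives the power.
open Classical in
lemma card_criticalFor_div_le (F : Finset (U → Fin ℓ))
    (hF : IsUniversal 2 (F : Set (U → Fin ℓ))) (T : Finset U) :
    (#{g ∈ Fintype.piFinset fun _ : Fin c => F | CriticalFor T g} : ℝ) /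
        #(Fintype.piFinset fun _ : Fin c => F) ≤ (2 * (#T : ℝ) ^ 2 / ℓ) ^ c := by
  have h1 : uniformPr (F : Set (U → Fin ℓ)) (fun f => ¬ Set.InjOn f T) ≤
      2 * (#T : ℝ) ^ 2 / ℓ := by
    calc uniformPr (F : Set (U → Fin ℓ)) (fun f => ¬ Set.InjOn f T)
        ≤ uniformPr (F : Set (U → Fin ℓ)) (fun f => ∃ p ∈ T.offDiag, f p.1 = f p.2) := by
          refine uniformPr_mono fun f _ hf => ?_
          simp only [Set.InjOn, mem_coe, not_forall] at hf
          obtain ⟨x, hx, y, hy, hxy, hne⟩ := hf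
          exact ⟨(x, y), mem_offDiag.2 ⟨hx, hy, hne⟩, hxy⟩
      _ ≤ ∑ p ∈ T.offDiag, uniformPr (F : Set (U → Fin ℓ)) (fun f => f p.1 = f p.2) :=
          uniformPr_exists_le _ _ _
      _ ≤ ∑ p ∈ T.offDiag, (2 / ℓ : ℝ) :=
          sum_le_sum fun p hp => hF.2 _ _ (mem_offDiag.1 hp).2.2
      _ = #T.offDiag * (2 / ℓ : ℝ) := by rw [sum_const, nsmul_eq_mul]
      _ ≤ (#T : ℝ) ^ 2 * (2 / ℓ : ℝ) := by
          gcongr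
          rw [offDiag_card, sq]
          exact_mod_cast Nat.sub_le _ _
      _ = _ := by ring
  have h2 : uniformPr (F : Set (U → Fin ℓ)) (fun f => ¬ Set.InjOn f T) =
      (#{f ∈ F | ¬ Set.InjOn f T} : ℝ) / #F := by
    unfold uniformPr
    rw [Set.ncard_coe_finset, ← Set.ncard_coe_finset {f ∈ F | ¬ Set.InjOn f T}, coe_filter]
    rfl
  rw [h2] at h1
  have h3 : ({g ∈ Fintype.piFinset fun _ : Fin c => F | CriticalFor T g} :
      Finset (Fin c → U → Fin ℓ)) ⊆ Fintype.piFinset fun _ => {f ∈ F | ¬ Set.InjOn f T} := by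
    intro g hg
    simp only [mem_filter, Fintype.mem_piFinset] at hg ⊢
    exact fun j => ⟨hg.1 j, hg.2.2 j⟩
  calc (#{g ∈ Fintype.piFinset fun _ : Fin c => F | CriticalFor T g} : ℝ) /
        #(Fintype.piFinset fun _ : Fin c => F)
      ≤ (#(Fintype.piFinset fun _ : Fin c => {f ∈ F | ¬ Set.InjOn f T}) : ℝ) /
        #(Fintype.piFinset fun _ : Fin c => F) := by
        gcongr
    _ = ((#{f ∈ F | ¬ Set.InjOn f T} : ℝ) / #F) ^ c := by
        rw [Fintype.card_piFinset, Fintype.card_piFinset]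
        simp [div_pow]
    _ ≤ _ := by gcongr

open Classical in
/-- The union bound over all explorations. -/
lemma uniformPr_excess_le [NeZero m] [NeZero c] (s : ℕ) (F : Finset (U → Fin ℓ))
    (hF : IsUniversal 2 (F : Set (U → Fin ℓ))) (H : Finset (U → Fin m)) (hHne : H.Nonempty)
    (hH : ∀ x y, x ≠ y → ∀ i j, #{f ∈ H | f x = i ∧ f y = j} * m ^ 2 ≤ #H) (S : Finset U) :
    uniformPr (hashClassZ c 2 (F : Set (U → Fin ℓ)) (H : Set (U → Fin m)))
        (fun h => s + 1 ≤ excess (keyGraph S (h.hash 0) (h.hash 1))) ≤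
      ∑ t ∈ range (#S + 1), (#S : ℝ) ^ t * (1 + t * (2 * (t + 1) ^ 2)) ^ (5 * (s + 1)) *
        (1 / (m : ℝ) ^ (t + (s + 1)) + (2 * (t : ℝ) ^ 2 / ℓ) ^ c / (m : ℝ) ^ (t - 1)) := by
  have hm : 0 < m := NeZero.pos m
  have hm1 : (1 : ℝ) ≤ m := by exact_mod_cast hm
  set Z := hashClassZ c 2 (F : Set (U → Fin ℓ)) (H : Set (U → Fin m)) with hZ
  set K := 5 * (s + 1)
  -- The deterministic conditions belong to the events, so pairs violating them contribute zero.
  -- `E₁` is a full exploration on a good list, `E₂` a critical tail.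
  let E₁ : ℕ → List U × List Instr → HashSeq U c 2 ℓ m → Prop := fun t p h =>
    (p.1.Nodup ∧ t + (s + 1) ≤ weight p.2) ∧ Sat h.hash p.2 p.1 ∧
      ∃ j, GoodFor p.1.toFinset (h.g j)
  let E₂ : ℕ → List U × List Instr → HashSeq U c 2 ℓ m → Prop := fun t p h =>
    (p.1.Nodup ∧ t ≤ weight p.2 + 1) ∧ Sat h.hash p.2 p.1 ∧ CriticalFor p.1.toFinset h.g
  have hcover : uniformPr Z (fun h => s + 1 ≤ excess (keyGraph S (h.hash 0) (h.hash 1))) ≤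
      uniformPr Z (fun h => ∃ t ∈ range (#S + 1), ∃ p ∈ listsOf S t ×ˢ codes t t K,
        E₁ t p h ∨ E₂ t p h) := by
    refine uniformPr_mono fun h _ hex => ?_
    obtain ⟨A, hAS, hA⟩ := exists_spanCard_add_le_card h.hash S s hex
    obtain ⟨is, L, hE, hw, hj⟩ := exists_exploration hA
    have hrange : ∀ L : List U, L.Nodup → (∀ x ∈ L, x ∈ A) → L.length ∈ range (#S + 1) := by
      intro L hL hLA
      rw [mem_range, Nat.lt_succ_iff, ← List.toFinset_card_of_nodup hL]
      exact card_le_card fun x hx => hAS (hLA x (by simpa using hx))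
    by_cases hgood : ∃ j, GoodFor L.toFinset (h.g j)
    · exact ⟨L.length, hrange L hE.nodup hE.mem, (L, is),
        mem_product.2 ⟨mem_listsOf fun x hx => hAS (hE.mem x hx), hE.sat.mem_codes le_rfl hj⟩,
        Or.inl ⟨⟨hE.nodup, hw.le⟩, hE.sat, hgood⟩⟩
    · obtain ⟨is', L', his, hL, hs, hcrit⟩ := hE.sat.exists_critical h.g hE.nodup hgood
      have hnodup : L'.Nodup := hE.nodup.sublist hL.sublist
      have hmem : ∀ x ∈ L', x ∈ A := fun x hx => hE.mem x (hL.subset hx)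
      refine ⟨L'.length, hrange L' hnodup hmem, (L', is'),
        mem_product.2 ⟨mem_listsOf fun x hx => hAS (hmem x hx), hs.mem_codes le_rfl ?_⟩,
        Or.inr ⟨⟨hnodup, ?_⟩, hs, hcrit⟩⟩
      · exact (his.sublist.countP_le).trans hj
      · rw [← hs.length_eq]
        exact hE.tails is' his
  refine hcover.trans ((uniformPr_exists_le _ _ _).trans (sum_le_sum fun t _ => ?_))
  refine (uniformPr_exists_le _ _ _).trans ?_
  have hterm : ∀ p ∈ listsOf S t ×ˢ codes t t K, uniformPr Z (fun h => E₁ t p h ∨ E₂ t p h) ≤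
      1 / (m : ℝ) ^ (t + (s + 1)) + (2 * (t : ℝ) ^ 2 / ℓ) ^ c / (m : ℝ) ^ (t - 1) := by
    rintro ⟨L, is⟩ hp
    have hlen := length_of_mem_listsOf (mem_product.1 hp).1
    simp only at hlen
    refine (uniformPr_or_le _ _ _).trans (add_le_add ?_ ?_)
    · by_cases hcond : L.Nodup ∧ t + (s + 1) ≤ weight is
      · have h1 := uniformPr_sat_le F H hHne hH L hcond.1 is
          (fun g : Fin c → U → Fin ℓ => ∃ j, GoodFor L.toFinset (g j)) (fun _ => id)
        refine (uniformPr_mono fun h _ hh => hh.2).trans (h1.trans ?_)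
        gcongr
        · apply div_le_one_of_le₀ _ (by positivity)
          refine Nat.cast_le.2 (card_le_card fun g hg => ?_)
          simp only [mem_filter] at hg
          exact hg.1
        · exact hcond.2
      · have : ∀ h, ¬ E₁ t (L, is) h := fun h hh => hcond hh.1
        simp only [this, uniformPr, and_false, Set.ofPred_false, Set.ncard_empty, Nat.cast_zero,
          zero_div]
        positivity
    · by_cases hcond : L.Nodup ∧ t ≤ weight is + 1
      · have h1 := uniformPr_sat_le F H hHne hH L hcond.1 is
          (fun g : Fin c → U → Fin ℓ => CriticalFor L.toFinset g) (fun _ hg => hg.1)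
        refine (uniformPr_mono fun h _ hh => hh.2).trans (h1.trans ?_)
        have h2 := card_criticalFor_div_le (c := c) F hF L.toFinset
        rw [List.toFinset_card_of_nodup hcond.1, hlen] at h2
        gcongr
        omega
      · have : ∀ h, ¬ E₂ t (L, is) h := fun h hh => hcond hh.1
        simp only [this, uniformPr, and_false, Set.ofPred_false, Set.ncard_empty, Nat.cast_zero,
          zero_div]
        positivity
  refine (sum_le_sum hterm).trans ?_
  rw [sum_const, nsmul_eq_mul, card_product]
  have h1 : ((#(listsOf S t) * #(codes t t K) : ℕ) : ℝ) ≤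
      (#S : ℝ) ^ t * (1 + t * (2 * (t + 1) ^ 2)) ^ K := by
    exact_mod_cast Nat.mul_le_mul (card_listsOf_le S t) (card_codes_le t t K)
  gcongr

end HashClass

/-! ### Summing the series -/

section Estimate

/-- The terms of the union bound are dominated by a convergent series. -/
lemma union_bound_term_le {ε δ : ℝ} (hε : 0 < ε) (hδ₀ : 0 < δ) {s c K : ℕ}
    (hc : ((s : ℝ) + 2) / δ ≤ c) {n m ℓ : ℕ} (hn : 1 ≤ n) (hm : (1 + ε) * (n : ℝ) ≤ m)
    (hℓ : ℓ = ⌊(n : ℝ) ^ δ⌋₊ ∨ ℓ = ⌈(n : ℝ) ^ δ⌉₊) (t : ℕ) :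
    (n : ℝ) ^ t * (1 + t * (2 * (t + 1) ^ 2)) ^ K *
        (1 / (m : ℝ) ^ (t + (s + 1)) + (2 * (t : ℝ) ^ 2 / ℓ) ^ c / (m : ℝ) ^ (t - 1)) ≤
      2 ^ K * (1 + (1 + ε) * 4 ^ c) * (((t : ℝ) + 1) ^ (3 * K + 2 * c) * (1 / (1 + ε)) ^ t) /
        (n : ℝ) ^ (s + 1) := by
  have hn1 : (1 : ℝ) ≤ n := by exact_mod_cast hn
  have hn0 : (0 : ℝ) < n := by linarith
  have he : (0 : ℝ) < 1 + ε := by linarith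
  have hm0 : (0 : ℝ) < m := lt_of_lt_of_le (by positivity) hm
  have hnm : (n : ℝ) ≤ m := by nlinarith
  have hq : (n : ℝ) / m ≤ 1 / (1 + ε) := by
    rw [div_le_div_iff₀ hm0 he]
    linarith
  have hc0 : c ≠ 0 := by
    rintro rfl
    have : (0 : ℝ) < (s + 2) / δ := by positivity
    simp at hc
    linarith
  set q := 1 / (1 + ε) with hqdef
  have hq0 : 0 < q := by positivity
  set T : ℝ := (t : ℝ) + 1 with hT
  have hT1 : 1 ≤ T := by simp [hT]
  -- This rests on `1 + 2 * t * (t + 1) ^ 2 ≤ 2 * (t + 1) ^ 3`.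
  have hpoly : ((1 : ℝ) + t * (2 * (t + 1) ^ 2)) ^ K ≤ 2 ^ K * T ^ (3 * K) := by
    rw [pow_mul, ← mul_pow]
    gcongr
    have : (0 : ℝ) ≤ t := by positivity
    simp only [hT]
    nlinarith [sq_nonneg (t : ℝ)]
  have h1 : (n : ℝ) ^ t * (1 / (m : ℝ) ^ (t + (s + 1))) ≤ q ^ t / (n : ℝ) ^ (s + 1) := by
    calc (n : ℝ) ^ t * (1 / (m : ℝ) ^ (t + (s + 1)))
        = (n / m : ℝ) ^ t / (m : ℝ) ^ (s + 1) := by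
          rw [div_pow, pow_add]
          field_simp
      _ ≤ _ := by gcongr
  -- Rounding down at most halves a real number that is at least 1.
  have hℓ1 : (n : ℝ) ^ δ / 2 ≤ ℓ := by
    have hx : (1 : ℝ) ≤ (n : ℝ) ^ δ := Real.one_le_rpow hn1 hδ₀.le
    have h2 : (n : ℝ) ^ δ < ⌊(n : ℝ) ^ δ⌋₊ + 1 := Nat.lt_floor_add_one _
    have h3 : (1 : ℝ) ≤ ⌊(n : ℝ) ^ δ⌋₊ := by
      exact_mod_cast Nat.le_floor (by exact_mod_cast hx)
    rcases hℓ with rfl | rfl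
    · linarith
    · have := Nat.le_ceil ((n : ℝ) ^ δ)
      linarith
  have hnδ : (0 : ℝ) < (n : ℝ) ^ δ := Real.rpow_pos_of_pos hn0 _
  -- The hypothesis on `c` enters here as `s + 2 ≤ δ * c`; the factor `2 ^ c` pays for rounding.
  have hℓc : (n : ℝ) ^ (s + 2) ≤ 2 ^ c * (ℓ : ℝ) ^ c := by
    calc (n : ℝ) ^ (s + 2) = (n : ℝ) ^ ((s + 2 : ℕ) : ℝ) := (Real.rpow_natCast _ _).symm
      _ ≤ (n : ℝ) ^ (δ * c) := by
          apply Real.rpow_le_rpow_of_exponent_le hn1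
          rw [div_le_iff₀ hδ₀] at hc
          push_cast
          linarith
      _ = ((n : ℝ) ^ δ) ^ c := by rw [Real.rpow_mul hn0.le, Real.rpow_natCast]
      _ ≤ (2 * (ℓ : ℝ)) ^ c := by
          gcongr
          linarith
      _ = _ := mul_pow _ _ _
  have hℓ0 : (0 : ℝ) < ℓ := by linarith
  have h2 : (n : ℝ) ^ t * ((2 * (t : ℝ) ^ 2 / ℓ) ^ c / (m : ℝ) ^ (t - 1)) ≤
      (1 + ε) * 4 ^ c * T ^ (2 * c) * q ^ t / (n : ℝ) ^ (s + 1) := by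
    -- For `t = 0` the exponent `t - 1` is truncated, but the term vanishes because `c ≠ 0`.
    rcases t with _ | u
    · rw [Nat.cast_zero, zero_pow two_ne_zero, mul_zero, zero_div, zero_pow hc0, zero_div,
        mul_zero]
      positivity
    rw [Nat.add_sub_cancel]
    calc (n : ℝ) ^ (u + 1) * ((2 * ((u + 1 : ℕ) : ℝ) ^ 2 / ℓ) ^ c / (m : ℝ) ^ u)
        = n * (n / m : ℝ) ^ u * (2 ^ c * ((u + 1 : ℕ) : ℝ) ^ (2 * c) / (ℓ : ℝ) ^ c) := by
          rw [div_pow, div_pow, mul_pow, ← pow_mul, pow_succ]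
          ring
      _ ≤ n * q ^ u * (2 ^ c * T ^ (2 * c) / ((n : ℝ) ^ (s + 2) / 2 ^ c)) := by
          gcongr
          · simp [hT]
          · rw [div_le_iff₀ (by positivity)]
            linarith
      _ = _ := by
          -- The missing coincidence of a critical tail costs `1 + ε` here, besides the factor `n`
          -- absorbed by `n ^ (s + 2)`.
          have hqe : q ^ u = (1 + ε) * q ^ (u + 1) := by
            rw [pow_succ, hqdef]
            field_simp
          have h4 : (4 : ℝ) ^ c = 2 ^ c * 2 ^ c := by rw [← mul_pow]; norm_num
          rw [hqe, h4, pow_succ (n : ℝ) (s + 1)]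
          field_simp
  calc (n : ℝ) ^ t * (1 + t * (2 * (t + 1) ^ 2)) ^ K *
        (1 / (m : ℝ) ^ (t + (s + 1)) + (2 * (t : ℝ) ^ 2 / ℓ) ^ c / (m : ℝ) ^ (t - 1))
      = (1 + t * (2 * (t + 1) ^ 2)) ^ K * ((n : ℝ) ^ t * (1 / (m : ℝ) ^ (t + (s + 1))) +
          (n : ℝ) ^ t * ((2 * (t : ℝ) ^ 2 / ℓ) ^ c / (m : ℝ) ^ (t - 1))) := by ring
    _ ≤ (2 ^ K * T ^ (3 * K)) * (T ^ (2 * c) * q ^ t / (n : ℝ) ^ (s + 1) +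
          (1 + ε) * 4 ^ c * T ^ (2 * c) * q ^ t / (n : ℝ) ^ (s + 1)) := by
        have h3 : q ^ t / (n : ℝ) ^ (s + 1) ≤ T ^ (2 * c) * q ^ t / (n : ℝ) ^ (s + 1) := by
          gcongr
          exact le_mul_of_one_le_left (by positivity) (one_le_pow₀ hT1)
        gcongr
        exact h1.trans h3
    _ = _ := by
        rw [pow_add]
        ring

lemma summable_union_bound {ε : ℝ} (hε : 0 < ε) (k : ℕ) :
    Summable fun t : ℕ => ((t : ℝ) + 1) ^ k * (1 / (1 + ε)) ^ t := by
  have hq0 : (0 : ℝ) < 1 / (1 + ε) := by positivity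
  have hq : ‖1 / (1 + ε)‖ < 1 := by
    rw [Real.norm_of_nonneg hq0.le, div_lt_one (by positivity)]
    linarith
  have h1 := (summable_nat_add_iff (f := fun t : ℕ => (t : ℝ) ^ k * (1 / (1 + ε)) ^ t) 1).2
    (summable_pow_mul_geometric_of_norm_lt_one k hq)
  refine (h1.mul_left (1 + ε)).congr fun t => ?_
  push_cast
  rw [pow_succ]
  field_simp

end Estimate

end CuckooStash

end

theorem mainTheorem3 (ε δ : ℝ) (hε : 0 < ε) (hδ₀ : 0 < δ) (hδ₁ : δ < 1) (s c : ℕ)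
    (hc : ((s : ℝ) + 2) / δ ≤ (c : ℝ)) :
    ∃ C : ℝ, ∀ (U : Type*) [Finite U] (n m ℓ : ℕ), 1 ≤ n → (1 + ε) * (n : ℝ) ≤ (m : ℝ) →
      (ℓ = ⌊(n : ℝ) ^ δ⌋₊ ∨ ℓ = ⌈(n : ℝ) ^ δ⌉₊) →
      ∀ (F : Set (U → Fin ℓ)) (H : Set (U → Fin m)),
        CuckooStash.IsUniversal 2 F → CuckooStash.IsWiseIndependent 2 H →
        ∀ S : Finset U, S.card = n →
          CuckooStash.uniformPr (CuckooStash.hashClassZ c 2 F H)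
              (fun h => s + 1 ≤
                CuckooStash.excess (CuckooStash.keyGraph S (h.hash 0) (h.hash 1))) ≤
            C / (n : ℝ) ^ (s + 1) := by
  -- The finite union bound is extended to a full series so that the constant does not depend on
  -- `n`.
  refine ⟨∑' t : ℕ, 2 ^ (5 * (s + 1)) * (1 + (1 + ε) * 4 ^ c) *
    (((t : ℝ) + 1) ^ (3 * (5 * (s + 1)) + 2 * c) * (1 / (1 + ε)) ^ t), ?_⟩
  intro U _ n m ℓ hn hm hℓ F H hF hH S hS
  classical
  have := Fintype.ofFinite U
  have hn1 : (1 : ℝ) ≤ n := by exact_mod_cast hn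
  have hm0 : (0 : ℝ) < m := lt_of_lt_of_le (by positivity) hm
  have : NeZero m := ⟨by rintro rfl; simp at hm0⟩
  have : NeZero c := ⟨by
    rintro rfl
    have : (0 : ℝ) < (s + 2) / δ := by positivity
    simp at hc
    linarith⟩
  obtain ⟨F, rfl⟩ := F.toFinite.exists_finset_coe
  obtain ⟨H, rfl⟩ := H.toFinite.exists_finset_coe
  have hHne : H.Nonempty := by simpa using hH.1
  have hH' : ∀ x y, x ≠ y → ∀ i j, (H.filter fun f => f x = i ∧ f y = j).card * m ^ 2 ≤
      H.card := by
    intro x y hxy i j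
    have h1 := hH.2 ![x, y] (by
      intro a b hab
      fin_cases a <;> fin_cases b <;> simp_all [hxy.symm]) ![i, j]
    unfold CuckooStash.uniformPr at h1
    have h2 : {f | f ∈ (H : Set (U → Fin m)) ∧ ∀ a : Fin 2, f (![x, y] a) = ![i, j] a} =
        (H.filter fun f => f x = i ∧ f y = j : Finset (U → Fin m)) := by
      ext f
      simp [Fin.forall_fin_two]
    rw [h2, Set.ncard_coe_finset, Set.ncard_coe_finset] at h1
    have h3 : (0 : ℝ) < H.card := by exact_mod_cast hHne.card_pos
    rw [div_eq_div_iff h3.ne' (by positivity), one_mul] at h1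
    exact_mod_cast h1.le
  refine (CuckooStash.uniformPr_excess_le s F hF H hHne hH' S).trans ?_
  rw [hS]
  refine (Finset.sum_le_sum fun t _ =>
    CuckooStash.union_bound_term_le hε hδ₀ hc hn hm hℓ t).trans ?_
  rw [← Finset.sum_div]
  gcongr
  exact ((CuckooStash.summable_union_bound hε _).mul_left _).sum_le_tsum _
    (fun t _ => by positivity)
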